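/- Let $\widehat f(\xi)=\int_{\mathbb R^3}e^{-ix\cdot\xi}f(x)\,dx$ be the Fourier transform on $\mathbb R^3$ (extended to $L^2(\mathbb R^3;\mathbb C)$ by Plancherel). Fix an even real-valued function $\chi\in C_0^\infty((-2,2))$ with $\chi(s)=1$ for $|s|\le 1$, and set $\rho_1(s)=\chi(s)$ and $\rho_\lambda(s)=\chi(s/\lambda)-\chi(2s/\lambda)$ for $\lambda>1$. For dyadic $\lambda\ge 1$ (that is, $\lambda=2^k$ with $k\in\mathbb Z$, $k\ge 0$) let $P_\lambda$ be the Fourier multiplier with symbol $\rho_\lambda(|\xi|)$, and write $f_\lambda=P_\lambda f$. For $m\ge 0$ and $t\in\mathbb R$ let $S_m(t)$ be the Fourier multiplier on $L^2(\mathbb R^3;\mathbb C)$ with symbol $e^{-it\sqrt{m^2+|\xi|^2}}$. Let $m\ge 0$ and let $K>1$. There is a constant $C>0$, depending only on $m$, $K$ and $\chi$, such that for all dyadic $\mu,\lambda_1,\lambda_2\ge 1$ and all $f,g\in L^2(\mathbb R^3;\mathbb C)$ the functions of $(t,x)$ on the left-hand sides belong to $L^2(\mathbb R^{1+3})$ in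 the cases indicated, and the following bounds hold. (i) ($++$ interaction) $$\bigl\|P_\mu\bigl(S_m(t)f_{\lambda_1}\cdot S_m(t)g_{\lambda_2}\bigr)\bigr\|_{L^2_{t,x}(\mathbb R^{1+3})}\le \begin{cases} C\min(\lambda_1,\lambda_2)\,\|f_{\lambda_1}\|_{L^2}\|g_{\lambda_2}\|_{L^2} & \text{if } K\lambda_1\le\lambda_2\text{ or }K\lambda_2\le\lambda_1,\\ C\,\mu\,\|f_{\lambda_1}\|_{L^2}\|g_{\lambda_2}\|_{L^2} & \text{if } \mu\le K\lambda_1 \text{ and } K^{-1}\lambda_2\le\lambda_1\le K\lambda_2.\end{cases}$$ (ii) ($+-$ interaction) $$\bigl\|P_\mu\bigl(S_m(t)f_{\lambda_1}\cdot S_m(-t)g_{\lambda_2}\bigr)\bigr\|_{L^2_{t,x}(\mathbb R^{1+3})}\le \begin{cases} C\min(\lambda_1,\lambda_2)\,\|f_{\lambda_1}\|_{L^2}\|g_{\lambda_2}\|_{L^2} & \text{if } K\lambda_1\le\lambda_2\text{ or }K\lambda_2\le\lambda_1,\\ C\,\mu^{1/2}\lambda_1^{1/2}\,\|f_{\lambda_1}\|_{L^2}\|g_{\lambda_2}\|_{L^2}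 & \text{if } \mu\le K\lambda_1 \text{ and } K^{-1}\lambda_2\le\lambda_1\le K\lambda_2.\end{cases}$$ -/

import Mathlib

open MeasureTheory
open scoped FourierTransform ENNReal

noncomputable section

namespace KleinGordon

/-- The space `ℝ³` with its Euclidean norm. -/
abbrev Space : Type := EuclideanSpace ℝ (Fin 3)

/-- The space `L²(ℝ³; ℂ)`. -/
abbrev L2 : Type := Lp (α := Space) ℂ 2 volume

/-- The even cut-off functions `χ ∈ C₀^∞((-2, 2))` with `χ = 1` on `[-1, 1]`. -/
structure Cutoff where
  toFun : ℝ → ℝ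
  contDiff : ContDiff ℝ (⊤ : ℕ∞) toFun
  hasCompactSupport : HasCompactSupport toFun
  tsupport_subset : tsupport toFun ⊆ Set.Ioo (-2) 2
  even : ∀ s, toFun (-s) = toFun s
  eq_one : ∀ s, |s| ≤ 1 → toFun s = 1

/-- The inhomogeneous dyadic cut-off `ρ_λ`. -/
def Cutoff.rho (χ : Cutoff) (lam s : ℝ) : ℝ :=
  if lam < 1 then 0
  else if lam = 1 then χ.toFun s
  else χ.toFun (s / lam) - χ.toFun (2 * s / lam)

/-- The dyadic numbers `2 ^ k`, `k ∈ ℤ`. -/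
def IsDyadic (lam : ℝ) : Prop := ∃ k : ℤ, lam = (2 : ℝ) ^ k

/-- The symbol `⟨ξ⟩_m = √(m² + |ξ|²)` as a function of `r = |ξ|`. -/
def japanese (m r : ℝ) : ℝ := Real.sqrt (m ^ 2 + r ^ 2)

/-- The symbol `ρ_λ(|ξ|)` of `P_λ`. Mathlib's Fourier transform has the kernel
`exp (-2πi ⟨x, ξ⟩)`, so the frequency with respect to the kernel `exp (-i ⟨x, ξ⟩)`
is `2πξ`. -/
def projSymbol (χ : Cutoff) (lam : ℝ) (ξ : Space) : ℂ :=
  (χ.rho lam (2 * Real.pi * ‖ξ‖) : ℂ)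

/-- The symbol `exp (-i t ⟨ξ⟩_m)` of `S_m(t)`, at the frequency `2πξ`. -/
def waveSymbol (m t : ℝ) (ξ : Space) : ℂ :=
  Complex.exp (((-(t * japanese m (2 * Real.pi * ‖ξ‖)) : ℝ) : ℂ) * Complex.I)

theorem Cutoff.continuous_rho (χ : Cutoff) (lam : ℝ) : Continuous (χ.rho lam) := by
  have h := χ.contDiff.continuous
  unfold Cutoff.rho
  split_ifs <;> fun_prop

theorem Cutoff.exists_rho_bound (χ : Cutoff) (lam : ℝ) : ∃ C, ∀ s, ‖χ.rho lam s‖ ≤ C := by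
  obtain ⟨C, hC⟩ := χ.hasCompactSupport.exists_bound_of_continuous χ.contDiff.continuous
  have hC0 : 0 ≤ C := (norm_nonneg _).trans (hC 0)
  refine ⟨C + C, fun s => ?_⟩
  unfold Cutoff.rho
  split_ifs
  · simpa using add_nonneg hC0 hC0
  · linarith [hC s]
  · exact (norm_sub_le _ _).trans (add_le_add (hC _) (hC _))

theorem memLp_projSymbol (χ : Cutoff) (lam : ℝ) : MemLp (projSymbol χ lam) ∞ volume := by
  obtain ⟨C, hC⟩ := χ.exists_rho_bound lam
  have h : Continuous (projSymbol χ lam) := by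
    have := χ.continuous_rho lam
    unfold projSymbol
    fun_prop
  refine memLp_top_of_bound h.aestronglyMeasurable C (Filter.Eventually.of_forall fun ξ => ?_)
  simpa [projSymbol] using hC (2 * Real.pi * ‖ξ‖)

theorem memLp_waveSymbol (m t : ℝ) : MemLp (waveSymbol m t) ∞ volume := by
  have h : Continuous (waveSymbol m t) := by
    unfold waveSymbol japanese
    fun_prop
  refine memLp_top_of_bound h.aestronglyMeasurable 1 (Filter.Eventually.of_forall fun ξ => ?_)
  exact (Complex.norm_exp_ofReal_mul_I _).le

/-- The Fourier multiplier `f ↦ 𝓕⁻¹ (a · 𝓕 f)` on `L²(ℝ³)` with bounded symbol `a`. -/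
def multiplier (a : Space → ℂ) (ha : MemLp a ∞ volume) (f : L2) : L2 :=
  𝓕⁻ ((ha.toLp a • 𝓕 f : L2) : L2)

/-- The frequency projection `P_λ` on `L²(ℝ³)`. -/
def proj (χ : Cutoff) (lam : ℝ) (f : L2) : L2 :=
  multiplier (projSymbol χ lam) (memLp_projSymbol χ lam) f

/-- The propagator `S_m(t) = exp (-i t ⟨D⟩_m)` on `L²(ℝ³)`. -/
def propagator (m t : ℝ) (f : L2) : L2 :=
  multiplier (waveSymbol m t) (memLp_waveSymbol m t) f

/-- The frequency projection `P_λ` on integrable functions, through Fourier integrals.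
It is applied below to the product of two functions in `L²(ℝ³)`. -/
def projFun (χ : Cutoff) (lam : ℝ) (u : Space → ℂ) : Space → ℂ :=
  𝓕⁻ (fun ξ : Space => projSymbol χ lam ξ * 𝓕 u ξ)

/-- The function `(t, x) ↦ P_μ (S_m(t) f · S_m(ε t) g) (x)`; the sign `ε = 1` gives the
(++) interaction and `ε = -1` the (+-) interaction. -/
def interaction (χ : Cutoff) (m mu ε : ℝ) (f g : L2) (p : ℝ × Space) : ℂ :=
  projFun χ mu (fun x => propagator m p.1 f x * propagator m (ε * p.1) g x) p.2

/-- `u ∈ L²(ℝ × ℝ³)` and `‖u‖ ≤ B`. -/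
def L2NormLe (u : ℝ × Space → ℂ) (B : ℝ) : Prop :=
  MemLp u 2 volume ∧ eLpNorm u 2 volume ≤ ENNReal.ofReal B

end KleinGordon

end

/-! By Plancherel in `x`, the spatial Fourier transform of the product is a convolution of evolved
profiles. In the (++) case, for fixed output frequency `ξ`, it is an oscillatory integral in `t`
with phase `ω(η) + ω(ξ - η)` and amplitude `F(η) G(ξ - η)`. If the phase pushes Lebesgue measure on
the support of the amplitude to at most `M` times Lebesgue measure, duality and Plancherel in `t`
bound the squared `L²_t` norm by `M ∫ |F(η)|² |G(ξ - η)|² dη`. Integrating in `ξ` gives `M ‖F‖²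
‖G‖²` (`lintegral_enorm_sq_conv_evolve_le`). Everything then rests on `M`.

Let `F` live at frequency `λ`. If its support has diameter at most `h`, slicing orthogonally to `ξ`
gives `M ≲ h λ` (`volume_resonance_ball_le`). If moreover `ξ - η` is nearly opposite to `η`, the two
gradients in the phase reinforce each other along `η` and `M ≲ h²`
(`volume_resonance_transversal_le`).

Without an output cut-off, (+-) reduces to (++): conjugating the second factor keeps the modulus of
the product and reverses the sign of its time. The output cut-off does not survive this step, so it
is first traded for a decomposition into cubes of side `μ`: the condition `|ξ| ≤ μ` pairs each cube
with boundedly many nearly opposite ones (`eLpNorm_indicator_waveConv_le_of_cells`).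

Taking `h ~ min(λ₁, λ₂)` gives the `min` bound, and `h ~ μ` gives `μ^(1/2) λ₁^(1/2)`. In the (++)
case the paired cubes are opposite, so the transversal bound gives `μ` when `μ ≪ λ₁`; otherwise the
bound `λ₁ ≲ μ` suffices. In the (+-) case reflection makes paired cubes nearly parallel, and
transversality is lost. -/

noncomputable section

namespace KleinGordon

/-! ### Fourier integrals on `L¹ ∩ L²`, Plancherel and convolutions. -/

section Fourier

variable {V : Type*} [NormedAddCommGroup V] [InnerProductSpace ℝ V] [FiniteDimensional ℝ V]
  [MeasurableSpace V] [BorelSpace V]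

theorem continuous_fourier {f : V → ℂ} (hf : Integrable f) : Continuous (𝓕 f) :=
  VectorFourier.fourierIntegral_continuous Real.continuous_fourierChar
    (innerSL ℝ).continuous₂ hf

theorem continuous_fourierInv {f : V → ℂ} (hf : Integrable f) : Continuous (𝓕⁻ f) := by
  rw [Real.fourierInv_eq_fourier_comp_neg]
  exact continuous_fourier hf.comp_neg

theorem integral_fourier_mul_eq {f g : V → ℂ} (hf : Integrable f) (hg : Integrable g) :
    ∫ ξ, 𝓕 f ξ * g ξ = ∫ x, f x * 𝓕 g x := by
  have h := VectorFourier.integral_fourierIntegral_smul_eq_flip (L := innerₗ V)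
    Real.continuous_fourierChar (continuous_inner (𝕜 := ℝ) (E := V)) hf hg
  rw [flip_innerₗ] at h
  exact h

/-- On `L¹ ∩ L²` the `L²` Fourier transform is given by the Fourier integral. -/
theorem fourier_toLp_ae_eq {f : V → ℂ} (h1 : Integrable f) (h2 : MemLp f 2 volume) :
    (𝓕 (h2.toLp f) : Lp (α := V) ℂ 2 volume) =ᵐ[volume] 𝓕 f := by
  refine ae_eq_of_integral_contDiff_smul_eq
    ((Lp.memLp _).locallyIntegrable (by norm_num))
    (continuous_fourier h1).locallyIntegrable fun g hg hgc => ?_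
  set gs : SchwartzMap V ℂ := (hgc.comp_left (g := ((↑) : ℝ → ℂ)) (by simp)).toSchwartzMap
    (Complex.ofRealCLM.contDiff.comp hg) with hgs
  have hgx : ∀ x, gs x = g x := fun x => rfl
  have key := congrArg (fun T : TemperedDistribution V ℂ => T gs)
    (Lp.fourier_toTemperedDistribution_eq (h2.toLp f))
  simp only [TemperedDistribution.fourier_apply, Lp.toTemperedDistribution_apply,
    smul_eq_mul] at key
  calc ∫ x, g x • (𝓕 (h2.toLp f) : Lp (α := V) ℂ 2 volume) x
      = ∫ x, gs x * (𝓕 (h2.toLp f) : Lp (α := V) ℂ 2 volume) x := by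
        simp [hgx]
    _ = ∫ x, 𝓕 (gs : V → ℂ) x * f x := by
        rw [← key]
        refine integral_congr_ae ?_
        filter_upwards [h2.coeFn_toLp] with x hx
        rw [hx, SchwartzMap.fourier_coe]
    _ = ∫ x, gs x * 𝓕 f x := integral_fourier_mul_eq gs.integrable h1
    _ = _ := by simp [hgx]

theorem fourierInv_toLp_ae_eq {f : V → ℂ} (h1 : Integrable f) (h2 : MemLp f 2 volume) :
    (𝓕⁻ (h2.toLp f) : Lp (α := V) ℂ 2 volume) =ᵐ[volume] 𝓕⁻ f := by
  refine ae_eq_of_integral_contDiff_smul_eq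
    ((Lp.memLp _).locallyIntegrable (by norm_num))
    (continuous_fourierInv h1).locallyIntegrable fun g hg hgc => ?_
  set gs : SchwartzMap V ℂ := (hgc.comp_left (g := ((↑) : ℝ → ℂ)) (by simp)).toSchwartzMap
    (Complex.ofRealCLM.contDiff.comp hg) with hgs
  have hgx : ∀ x, gs x = g x := fun x => rfl
  have key := congrArg (fun T : TemperedDistribution V ℂ => T gs)
    (Lp.fourierInv_toTemperedDistribution_eq (h2.toLp f))
  simp only [TemperedDistribution.fourierInv_apply, Lp.toTemperedDistribution_apply,
    smul_eq_mul] at key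
  calc ∫ x, g x • (𝓕⁻ (h2.toLp f) : Lp (α := V) ℂ 2 volume) x
      = ∫ x, gs x * (𝓕⁻ (h2.toLp f) : Lp (α := V) ℂ 2 volume) x := by
        simp [hgx]
    _ = ∫ x, 𝓕⁻ (gs : V → ℂ) x * f x := by
        rw [← key]
        refine integral_congr_ae ?_
        filter_upwards [h2.coeFn_toLp] with x hx
        rw [hx, SchwartzMap.fourierInv_coe]
    _ = ∫ x, 𝓕 (gs : V → ℂ) x * f (-x) := by
        rw [← integral_neg_eq_self]
        simp [Real.fourierInv_eq_fourier_neg]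
    _ = ∫ x, gs x * 𝓕 (fun y => f (-y)) x :=
        integral_fourier_mul_eq gs.integrable h1.comp_neg
    _ = _ := by simp [hgx, Real.fourierInv_eq_fourier_comp_neg]

theorem lintegral_enorm_sq_eq_eLpNorm_sq {α : Type*} [MeasurableSpace α] {μ : Measure α}
    (f : α → ℂ) : ∫⁻ x, ‖f x‖ₑ ^ 2 ∂μ = eLpNorm f 2 μ ^ 2 := by
  rw [eLpNorm_eq_lintegral_rpow_enorm_toReal (by norm_num) (by norm_num)]
  simp only [ENNReal.toReal_ofNat, one_div, ENNReal.rpow_ofNat]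
  rw [← ENNReal.rpow_ofNat, ← ENNReal.rpow_mul]
  norm_num

/-- Plancherel's theorem for Fourier integrals. -/
theorem lintegral_enorm_sq_fourier {f : V → ℂ} (h1 : Integrable f) (h2 : MemLp f 2 volume) :
    ∫⁻ ξ, ‖𝓕 f ξ‖ₑ ^ 2 = ∫⁻ x, ‖f x‖ₑ ^ 2 := by
  rw [lintegral_enorm_sq_eq_eLpNorm_sq, lintegral_enorm_sq_eq_eLpNorm_sq,
    ← eLpNorm_congr_ae (fourier_toLp_ae_eq h1 h2), ← Lp.enorm_def, ← ofReal_norm,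
    Lp.norm_fourier_eq, ofReal_norm, Lp.enorm_def, eLpNorm_congr_ae h2.coeFn_toLp]

theorem lintegral_enorm_sq_fourierInv {f : V → ℂ} (h1 : Integrable f)
    (h2 : MemLp f 2 volume) :
    ∫⁻ ξ, ‖𝓕⁻ f ξ‖ₑ ^ 2 = ∫⁻ x, ‖f x‖ₑ ^ 2 := by
  rw [← lintegral_enorm_sq_fourier h1 h2,
    ← (Measure.measurePreserving_neg (volume : Measure V)).lintegral_comp_emb
      (MeasurableEquiv.neg V).measurableEmbedding]
  simp [Real.fourierInv_eq_fourier_neg]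

theorem memLp_fourierInv {f : V → ℂ} (h1 : Integrable f) (h2 : MemLp f 2 volume) :
    MemLp (𝓕⁻ f) 2 volume :=
  (memLp_congr_ae (fourierInv_toLp_ae_eq h1 h2)).1 (Lp.memLp _)

/-- The convolution of two complex-valued functions. -/
def conv (f g : V → ℂ) (ξ : V) : ℂ := ∫ η, f η * g (ξ - η)

theorem integrable_conv {f g : V → ℂ} (hf : Integrable f) (hg : Integrable g) :
    Integrable (conv f g) :=
  hf.integrable_convolution (ContinuousLinearMap.mul ℂ ℂ) hg

theorem fourier_conv {f g : V → ℂ} (hf : Integrable f) (hg : Integrable g) (x : V) :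
    𝓕 (conv f g) x = 𝓕 f x * 𝓕 g x :=
  Real.fourier_mul_convolution_eq hf hg x

theorem fourierInv_conv {f g : V → ℂ} (hf : Integrable f) (hg : Integrable g) :
    𝓕⁻ (conv f g) = 𝓕⁻ f * 𝓕⁻ g := by
  ext x
  simp only [Real.fourierInv_eq_fourier_neg, Pi.mul_apply, fourier_conv hf hg]

theorem memLp_comp_sub_left {g : V → ℂ} (hg : MemLp g 2 volume) (ξ : V) :
    MemLp (fun η => g (ξ - η)) 2 volume :=
  hg.comp_measurePreserving (Measure.measurePreserving_sub_left volume ξ)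

theorem integrable_mul_comp_sub {f g : V → ℂ} (hf : MemLp f 2 volume)
    (hg : MemLp g 2 volume) (ξ : V) : Integrable fun η => f η * g (ξ - η) :=
  hf.integrable_mul (memLp_comp_sub_left hg ξ)

theorem norm_conv_le {f g : V → ℂ} (hf : MemLp f 2 volume)
    (hg : MemLp g 2 volume) : ∃ C, ∀ ξ, ‖conv f g ξ‖ ≤ C := by
  refine ⟨(∫ η, ‖f η‖ ^ 2) + ∫ η, ‖g η‖ ^ 2, fun ξ => ?_⟩
  have hf2 := hf.integrable_norm_pow (by norm_num)
  have hg2 := (memLp_comp_sub_left hg ξ).integrable_norm_pow (by norm_num)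
  calc ‖conv f g ξ‖ ≤ ∫ η, ‖f η * g (ξ - η)‖ := norm_integral_le_integral_norm _
    _ ≤ ∫ η, (‖f η‖ ^ 2 + ‖g (ξ - η)‖ ^ 2) := by
        refine integral_mono (integrable_mul_comp_sub hf hg ξ).norm
          (hf2.add hg2) fun η => ?_
        simp only [norm_mul]
        nlinarith [sq_nonneg (‖f η‖ - ‖g (ξ - η)‖), sq_nonneg (‖f η‖ + ‖g (ξ - η)‖)]
    _ = _ := by
        rw [integral_add hf2 hg2]
        congr 1
        exact integral_sub_left_eq_self (fun η => ‖g η‖ ^ 2) volume ξ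

/-- A convolution of `L²` functions is bounded, one of `L¹` functions is integrable, and bounded
integrable functions are square integrable. -/
theorem memLp_conv {f g : V → ℂ} (hf : Integrable f) (hf2 : MemLp f 2 volume)
    (hg : Integrable g) (hg2 : MemLp g 2 volume) : MemLp (conv f g) 2 volume := by
  obtain ⟨C, hC⟩ := norm_conv_le hf2 hg2
  have hi := integrable_conv hf hg
  have hi2 := hi.norm.const_mul C
  refine (memLp_two_iff_integrable_sq_norm hi.1).2 (hi2.mono' (hi.1.norm.pow 2) ?_)
  refine Filter.Eventually.of_forall fun ξ => ?_
  rw [norm_pow, norm_norm, sq]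
  exact mul_le_mul_of_nonneg_right (hC ξ) (norm_nonneg _)

/-- The Fourier transform of a product is the convolution of the Fourier transforms. -/
theorem fourier_fourierInv_mul_ae_eq {f g : V → ℂ} (hf : Integrable f)
    (hf2 : MemLp f 2 volume) (hg : Integrable g) (hg2 : MemLp g 2 volume) :
    𝓕 (𝓕⁻ f * 𝓕⁻ g) =ᵐ[volume] conv f g := by
  have hc1 := integrable_conv hf hg
  have hc2 := memLp_conv hf hf2 hg hg2
  have hp1 : Integrable (𝓕⁻ f * 𝓕⁻ g) :=
    (memLp_fourierInv hf hf2).integrable_mul (memLp_fourierInv hg hg2)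
  have hp2 : MemLp (𝓕⁻ f * 𝓕⁻ g) 2 volume := by
    rw [← fourierInv_conv hf hg]
    exact memLp_fourierInv hc1 hc2
  -- The inversion is done in `L²`, since `𝓕⁻ f * 𝓕⁻ g` need not have an integrable Fourier
  -- transform known beforehand.
  have he : hp2.toLp _ = 𝓕⁻ (hc2.toLp _) := by
    refine Lp.ext ?_
    filter_upwards [hp2.coeFn_toLp, fourierInv_toLp_ae_eq hc1 hc2] with x h1 h2
    rw [h1, h2, fourierInv_conv hf hg]
  have h := fourier_toLp_ae_eq hp1 hp2
  rw [he, FourierTransform.fourier_fourierInv_eq] at h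
  exact h.symm.trans hc2.coeFn_toLp

/-- Plancherel's theorem for a product. -/
theorem lintegral_enorm_sq_conv {f g : V → ℂ} (hf : Integrable f)
    (hf2 : MemLp f 2 volume) (hg : Integrable g) (hg2 : MemLp g 2 volume) :
    ∫⁻ ξ, ‖conv f g ξ‖ₑ ^ 2 = ∫⁻ x, ‖𝓕⁻ f x‖ₑ ^ 2 * ‖𝓕⁻ g x‖ₑ ^ 2 := by
  rw [← lintegral_enorm_sq_fourierInv (integrable_conv hf hg) (memLp_conv hf hf2 hg hg2),
    fourierInv_conv hf hg]
  simp [mul_pow]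

end Fourier

/-! ### Oscillatory integrals in time, by duality. -/

section Duality

theorem sq_lintegral_mul_le {α : Type*} [MeasurableSpace α] {μ : Measure α} {f g : α → ℝ≥0∞}
    (hf : AEMeasurable f μ) (hg : AEMeasurable g μ) :
    (∫⁻ x, f x * g x ∂μ) ^ 2 ≤ (∫⁻ x, f x ^ 2 ∂μ) * ∫⁻ x, g x ^ 2 ∂μ := by
  have h := ENNReal.lintegral_mul_le_Lp_mul_Lq μ (p := 2) (q := 2)
    (Real.holderConjugate_iff.2 ⟨by norm_num, by norm_num⟩) hf hg
  calc (∫⁻ x, f x * g x ∂μ) ^ 2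
      ≤ ((∫⁻ x, f x ^ (2 : ℝ) ∂μ) ^ (1 / 2 : ℝ) * (∫⁻ x, g x ^ (2 : ℝ) ∂μ) ^ (1 / 2 : ℝ)) ^ 2 :=
        pow_le_pow_left' h 2
    _ = _ := by
        rw [mul_pow, ← ENNReal.rpow_natCast, ← ENNReal.rpow_mul, ← ENNReal.rpow_natCast,
          ← ENNReal.rpow_mul]
        norm_num

variable {X : Type*} [MeasurableSpace X] {ν : Measure X} {ψ : X → ℝ} {h : X → ℂ}

/-- The oscillatory integral `∫ exp(-2πi t ψ) h dν`. -/
def oscInt (ν : Measure X) (ψ : X → ℝ) (h : X → ℂ) (t : ℝ) : ℂ :=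
  ∫ x, (Real.fourierChar (-(t * ψ x)) : ℂ) * h x ∂ν

theorem stronglyMeasurable_oscInt [SFinite ν] (hψ : Measurable ψ) (hh : StronglyMeasurable h) :
    StronglyMeasurable (oscInt ν ψ h) := by
  refine StronglyMeasurable.integral_prod_right'
    (f := fun p : ℝ × X => (Real.fourierChar (-(p.1 * ψ p.2)) : ℂ) * h p.2) ?_
  refine StronglyMeasurable.mul ?_ (hh.comp_measurable measurable_snd)
  have hc : Continuous fun s : ℝ => (Real.fourierChar (-s) : ℂ) := by fun_prop
  exact hc.stronglyMeasurable.comp_measurable (measurable_fst.mul (hψ.comp measurable_snd))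

theorem norm_oscInt_le (t : ℝ) : ‖oscInt ν ψ h t‖ ≤ ∫ x, ‖h x‖ ∂ν :=
  (norm_integral_le_integral_norm _).trans_eq (by simp only [norm_mul, Circle.norm_coe, one_mul])

/-- Fubini moves the time integral onto `k`; this identifies the dual of `h ↦ oscInt ν ψ h`, to
which Plancherel in `t` applies. -/
theorem integral_mul_oscInt [SFinite ν] (hψ : Measurable ψ) (hh : Integrable h ν) {k : ℝ → ℂ}
    (hk : Integrable k) :
    ∫ t, k t * oscInt ν ψ h t = ∫ x, h x * 𝓕 k (ψ x) ∂ν := by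
  have hc : Continuous fun s : ℝ => (Real.fourierChar (-s) : ℂ) := by fun_prop
  have hm : Measurable fun p : ℝ × X => p.1 * ψ p.2 :=
    measurable_fst.mul (hψ.comp measurable_snd)
  have hint : Integrable (fun p : ℝ × X =>
      k p.1 * ((Real.fourierChar (-(p.1 * ψ p.2)) : ℂ) * h p.2)) (volume.prod ν) := by
    refine (hk.mul_prod hh).mono ?_ (Filter.Eventually.of_forall fun p => ?_)
    · exact hk.1.comp_fst.mul
        ((hc.stronglyMeasurable.comp_measurable hm).aestronglyMeasurable.mul hh.1.comp_snd)
    · simp only [norm_mul, Circle.norm_coe, one_mul, le_refl]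
  calc ∫ t, k t * oscInt ν ψ h t
      = ∫ t, ∫ x, k t * ((Real.fourierChar (-(t * ψ x)) : ℂ) * h x) ∂ν := by
        simp only [oscInt, integral_const_mul]
    _ = ∫ x, (∫ t : ℝ, k t * ((Real.fourierChar (-(t * ψ x)) : ℂ) * h x)) ∂ν :=
        integral_integral_swap hint
    _ = ∫ x, h x * 𝓕 k (ψ x) ∂ν := by
        refine integral_congr_ae (Filter.Eventually.of_forall fun x => ?_)
        simp only [Real.fourier_real_eq, Circle.smul_def, smul_eq_mul, ← integral_const_mul]
        refine integral_congr_ae (Filter.Eventually.of_forall fun t => ?_)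
        ring

theorem lintegral_comp_le_of_measure_le (hψ : Measurable ψ) {A : Set X} {M : ℝ≥0∞}
    (hA : ∀ I : Set ℝ, MeasurableSet I → ν (A ∩ ψ ⁻¹' I) ≤ M * volume I)
    {g : ℝ → ℝ≥0∞} (hg : Measurable g) :
    ∫⁻ x in A, g (ψ x) ∂ν ≤ M * ∫⁻ s, g s := by
  rw [← lintegral_map hg hψ, ← smul_eq_mul, ← lintegral_smul_measure]
  refine lintegral_mono' (Measure.le_iff.2 fun I hI => ?_) le_rfl
  rw [Measure.map_apply hψ hI, Measure.restrict_apply (hψ hI), Set.inter_comm]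
  simpa using hA I hI

/-- If the push-forward under `ψ` of `ν` restricted to the support of `h` is at most `M` times
Lebesgue measure, then the oscillatory integral is bounded in `L²`. -/
theorem lintegral_enorm_sq_oscInt_le [SFinite ν] (hψ : Measurable ψ) (hsm : StronglyMeasurable h)
    (hh : Integrable h ν) {M : ℝ≥0∞}
    (hA : ∀ I : Set ℝ, MeasurableSet I → ν ({x | h x ≠ 0} ∩ ψ ⁻¹' I) ≤ M * volume I) :
    ∫⁻ t, ‖oscInt ν ψ h t‖ₑ ^ 2 ≤ M * ∫⁻ x, ‖h x‖ₑ ^ 2 ∂ν := by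
  have hH := stronglyMeasurable_oscInt (ν := ν) hψ hsm
  -- A priori the oscillatory integral is only bounded in `t`. On `[-n, n]` its square has a finite
  -- integral, which can be cancelled at the end; the bound is uniform in `n`.
  have hcover := aecover_Icc (μ := (volume : Measure ℝ))
    (Filter.tendsto_neg_atTop_atBot.comp tendsto_natCast_atTop_atTop)
    (tendsto_natCast_atTop_atTop (R := ℝ))
  refine le_of_tendsto' (hcover.lintegral_tendsto_of_countably_generated
    (f := fun t => ‖oscInt ν ψ h t‖ₑ ^ 2) (hH.enorm.pow_const 2).aemeasurable) fun n => ?_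
  set S : Set ℝ := Set.Icc (-(n : ℝ)) n
  change ∫⁻ t in S, ‖oscInt ν ψ h t‖ₑ ^ 2 ≤ _
  have hS : MeasurableSet S := measurableSet_Icc
  have hSfin : volume S ≠ ∞ := by simp [S]
  set k : ℝ → ℂ := S.indicator fun t => (starRingEnd ℂ) (oscInt ν ψ h t) with hk
  have hksm : StronglyMeasurable k :=
    (Complex.continuous_conj.comp_stronglyMeasurable hH).indicator hS
  have hkb : ∀ p : ℝ≥0∞, MemLp k p volume := fun p => by
    rw [hk, memLp_indicator_iff_restrict hS]
    have : IsFiniteMeasure (volume.restrict S) := ⟨by simpa using hSfin.lt_top⟩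
    exact MemLp.of_bound (Complex.continuous_conj.comp_stronglyMeasurable hH).aestronglyMeasurable
      (∫ x, ‖h x‖ ∂ν) (Filter.Eventually.of_forall fun t => by
        simpa using norm_oscInt_le t)
  have hk1 : Integrable k := memLp_one_iff_integrable.1 (hkb 1)
  have hk2 : ∫⁻ t in S, ‖oscInt ν ψ h t‖ₑ ^ 2 = ∫⁻ t, ‖k t‖ₑ ^ 2 := by
    rw [← lintegral_indicator hS]
    refine lintegral_congr fun t => ?_
    by_cases ht : t ∈ S <;> simp [hk, ht]
  have hfin : ∫⁻ t, ‖k t‖ₑ ^ 2 ≠ ∞ := by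
    rw [lintegral_enorm_sq_eq_eLpNorm_sq]
    exact ENNReal.pow_ne_top (hkb 2).2.ne
  have hpair : ∫⁻ t, ‖k t‖ₑ ^ 2 = ‖∫ t, k t * oscInt ν ψ h t‖ₑ := by
    have hpt : ∀ t, k t * oscInt ν ψ h t = ((‖k t‖ ^ 2 : ℝ) : ℂ) := fun t => by
      by_cases ht : t ∈ S
      · simp [hk, ht, ← Complex.conj_mul']
      · simp [hk, ht]
    simp only [hpt]
    rw [integral_complex_ofReal]
    have hnn : 0 ≤ ∫ t, ‖k t‖ ^ 2 := integral_nonneg fun t => by positivity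
    rw [← ofReal_norm, Complex.norm_real, Real.norm_eq_abs, abs_of_nonneg hnn,
      ofReal_integral_eq_lintegral_ofReal]
    · refine lintegral_congr fun t => ?_
      rw [ENNReal.ofReal_pow (norm_nonneg _), ofReal_norm]
    · exact (memLp_two_iff_integrable_sq_norm hksm.aestronglyMeasurable).1 (hkb 2)
    · exact Filter.Eventually.of_forall fun t => by positivity
  set A : Set X := {x | h x ≠ 0} with hAdef
  have hAm : MeasurableSet A := hsm.measurable (measurableSet_singleton 0).compl
  have hFk : Measurable (𝓕 k) := (continuous_fourier hk1).measurable
  -- With `X = ‖k‖²`, duality, Cauchy-Schwarz, the push-forward bound and Plancherel give `X² ≤ M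
  -- ‖h‖² X`.
  have hle : (∫⁻ t, ‖k t‖ₑ ^ 2) ^ 2 ≤ (M * ∫⁻ x, ‖h x‖ₑ ^ 2 ∂ν) * ∫⁻ t, ‖k t‖ₑ ^ 2 := by
    calc (∫⁻ t, ‖k t‖ₑ ^ 2) ^ 2 = ‖∫ x, h x * 𝓕 k (ψ x) ∂ν‖ₑ ^ 2 := by
          rw [← integral_mul_oscInt hψ hh hk1, ← hpair]
      _ ≤ (∫⁻ x, ‖h x * 𝓕 k (ψ x)‖ₑ ∂ν) ^ 2 :=
          pow_le_pow_left' (enorm_integral_le_lintegral_enorm _) 2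
      _ = (∫⁻ x in A, ‖h x‖ₑ * ‖𝓕 k (ψ x)‖ₑ ∂ν) ^ 2 := by
          rw [← lintegral_indicator hAm]
          congr 1
          refine lintegral_congr fun x => ?_
          by_cases hx : h x = 0 <;> simp [A, hx]
      _ ≤ (∫⁻ x in A, ‖h x‖ₑ ^ 2 ∂ν) * ∫⁻ x in A, ‖𝓕 k (ψ x)‖ₑ ^ 2 ∂ν :=
          sq_lintegral_mul_le hsm.enorm.aemeasurable (hFk.comp hψ).enorm.aemeasurable
      _ ≤ (∫⁻ x, ‖h x‖ₑ ^ 2 ∂ν) * (M * ∫⁻ s, ‖𝓕 k s‖ₑ ^ 2) :=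
          mul_le_mul' (setLIntegral_le_lintegral _ _)
            (lintegral_comp_le_of_measure_le hψ hA (hFk.enorm.pow_const 2))
      _ = _ := by
          rw [lintegral_enorm_sq_fourier hk1 (hkb 2)]
          ring
  rw [hk2]
  by_cases h0 : ∫⁻ t, ‖k t‖ₑ ^ 2 = 0
  · simp [h0]
  · rw [sq] at hle
    exact (ENNReal.mul_le_mul_iff_left h0 hfin).1 hle

end Duality

/-! ### Free waves on the Fourier side and the reduction of (+-) to (++). -/

section Evolution

/-- The dispersion relation `√(m² + |ξ|²)` on `ℝ³`. -/
def omega (m : ℝ) (ξ : Space) : ℝ := japanese m ‖ξ‖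

/-- The free evolution `exp(-2πi t √(m² + |ξ|²)) F(ξ)` on the Fourier side. -/
def evolve (m t : ℝ) (F : Space → ℂ) (ξ : Space) : ℂ :=
  (Real.fourierChar (-(t * omega m ξ)) : ℂ) * F ξ

theorem continuous_omega (m : ℝ) : Continuous (omega m) := by
  unfold omega japanese
  fun_prop

theorem omega_neg (m : ℝ) (ξ : Space) : omega m (-ξ) = omega m ξ := by
  simp [omega]

theorem continuous_phase (m : ℝ) :
    Continuous fun p : ℝ × Space => (Real.fourierChar (-(p.1 * omega m p.2)) : ℂ) := by
  have := continuous_omega m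
  fun_prop

theorem enorm_evolve (m t : ℝ) (F : Space → ℂ) (ξ : Space) :
    ‖evolve m t F ξ‖ₑ = ‖F ξ‖ₑ := by
  rw [← ofReal_norm, ← ofReal_norm, evolve, norm_mul, Circle.norm_coe, one_mul]

variable {m t : ℝ} {F G : Space → ℂ}

theorem stronglyMeasurable_evolve_uncurry (hF : StronglyMeasurable F) :
    StronglyMeasurable fun p : ℝ × Space => evolve m p.1 F p.2 :=
  (continuous_phase m).stronglyMeasurable.mul (hF.comp_measurable measurable_snd)

theorem stronglyMeasurable_evolve (hF : StronglyMeasurable F) :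
    StronglyMeasurable (evolve m t F) := by
  have hc : Continuous fun ξ : Space => (Real.fourierChar (-(t * omega m ξ)) : ℂ) := by
    have := continuous_omega m
    fun_prop
  exact hc.stronglyMeasurable.mul hF

theorem memLp_evolve {p : ℝ≥0∞} (hF : StronglyMeasurable F) (h : MemLp F p volume) :
    MemLp (evolve m t F) p volume :=
  h.congr_enorm (stronglyMeasurable_evolve hF).aestronglyMeasurable
    (Filter.Eventually.of_forall fun ξ => (enorm_evolve m t F ξ).symm)

theorem integrable_evolve (hF : StronglyMeasurable F) (h : Integrable F) :
    Integrable (evolve m t F) :=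
  memLp_one_iff_integrable.1 (memLp_evolve hF (memLp_one_iff_integrable.2 h))

theorem stronglyMeasurable_conv_evolve (ε : ℝ) (hF : StronglyMeasurable F)
    (hG : StronglyMeasurable G) :
    StronglyMeasurable fun p : ℝ × Space =>
      conv (evolve m p.1 F) (evolve m (ε * p.1) G) p.2 := by
  refine StronglyMeasurable.integral_prod_right' (f := fun q : (ℝ × Space) × Space =>
    evolve m q.1.1 F q.2 * evolve m (ε * q.1.1) G (q.1.2 - q.2)) ?_
  refine StronglyMeasurable.mul ?_ ?_
  · exact (stronglyMeasurable_evolve_uncurry hF).comp_measurable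
      (g := fun q : (ℝ × Space) × Space => (q.1.1, q.2)) (by fun_prop)
  · exact (stronglyMeasurable_evolve_uncurry hG).comp_measurable
      (g := fun q : (ℝ × Space) × Space => (ε * q.1.1, q.1.2 - q.2)) (by fun_prop)

theorem conv_evolve_eq_oscInt (m t : ℝ) (F G : Space → ℂ) (ξ : Space) :
    conv (evolve m t F) (evolve m t G) ξ =
      oscInt volume (fun η => omega m η + omega m (ξ - η)) (fun η => F η * G (ξ - η)) t := by
  refine integral_congr_ae (Filter.Eventually.of_forall fun η => ?_)
  simp only [evolve, mul_add, neg_add, AddChar.map_add_eq_mul, Circle.coe_mul]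
  ring

theorem lintegral_lintegral_mul_comp_sub {f g : Space → ℝ≥0∞} (hf : Measurable f)
    (hg : Measurable g) :
    ∫⁻ ξ, ∫⁻ η, f η * g (ξ - η) = (∫⁻ η, f η) * ∫⁻ η, g η := by
  rw [lintegral_lintegral_swap (by fun_prop), ← lintegral_mul_const _ hf]
  refine lintegral_congr fun η => ?_
  rw [lintegral_const_mul _ (by fun_prop), lintegral_sub_right_eq_self g η]

/-- The basic bilinear estimate on the Fourier side: the bound is the density of the push-forward
of Lebesgue measure under the resonance function. -/
theorem lintegral_enorm_sq_conv_evolve_le (hF : StronglyMeasurable F) (hG : StronglyMeasurable G)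
    (hF2 : MemLp F 2 volume) (hG2 : MemLp G 2 volume) {M : ℝ≥0∞}
    (hM : ∀ (ξ : Space) (I : Set ℝ), MeasurableSet I →
      volume {η | F η ≠ 0 ∧ G (ξ - η) ≠ 0 ∧ omega m η + omega m (ξ - η) ∈ I} ≤ M * volume I) :
    ∫⁻ t, ∫⁻ ξ, ‖conv (evolve m t F) (evolve m t G) ξ‖ₑ ^ 2 ≤
      M * ((∫⁻ η, ‖F η‖ₑ ^ 2) * ∫⁻ η, ‖G η‖ₑ ^ 2) := by
  have hω := (continuous_omega m).measurable
  have hmeas := stronglyMeasurable_conv_evolve (m := m) 1 hF hG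
  simp only [one_mul] at hmeas
  rw [lintegral_lintegral_swap (hmeas.enorm.pow_const 2).aemeasurable,
    ← lintegral_lintegral_mul_comp_sub (hF.enorm.pow_const 2) (hG.enorm.pow_const 2),
    ← lintegral_const_mul]
  · refine lintegral_mono fun ξ => ?_
    simp only [conv_evolve_eq_oscInt]
    refine (lintegral_enorm_sq_oscInt_le (M := M) (by fun_prop)
      (hF.mul (hG.comp_measurable (by fun_prop)))
      (integrable_mul_comp_sub hF2 hG2 ξ) fun I hI => ?_).trans_eq ?_
    · refine le_trans (measure_mono fun η hη => ?_) (hM ξ I hI)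
      exact ⟨left_ne_zero_of_mul hη.1, right_ne_zero_of_mul hη.1, hη.2⟩
    · simp [mul_pow]
  · exact Measurable.lintegral_prod_right' (f := fun p : Space × Space =>
      ‖F p.2‖ₑ ^ 2 * ‖G (p.1 - p.2)‖ₑ ^ 2)
      (((hF.enorm.comp measurable_snd).pow_const 2).mul
        ((hG.enorm.comp (measurable_fst.sub measurable_snd)).pow_const 2))

/-- The `L²` norm squared of the product of two free waves. -/
def bilin (m : ℝ) (F G : Space → ℂ) : ℝ≥0∞ :=
  ∫⁻ t, ∫⁻ x, ‖𝓕⁻ (evolve m t F) x‖ₑ ^ 2 * ‖𝓕⁻ (evolve m t G) x‖ₑ ^ 2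

theorem bilin_comm (m : ℝ) (F G : Space → ℂ) : bilin m F G = bilin m G F := by
  simp only [bilin, mul_comm]

/-- The Fourier transform of the complex conjugate. -/
def reflect (G : Space → ℂ) (ξ : Space) : ℂ := (starRingEnd ℂ) (G (-ξ))

theorem stronglyMeasurable_reflect (hG : StronglyMeasurable G) :
    StronglyMeasurable (reflect G) :=
  Complex.continuous_conj.comp_stronglyMeasurable (hG.comp_measurable measurable_neg)

theorem memLp_reflect {p : ℝ≥0∞} (h : MemLp G p volume) : MemLp (reflect G) p volume :=
  (h.comp_measurePreserving (Measure.measurePreserving_neg volume)).star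

theorem lintegral_enorm_sq_reflect (G : Space → ℂ) :
    ∫⁻ η, ‖reflect G η‖ₑ ^ 2 = ∫⁻ η, ‖G η‖ₑ ^ 2 := by
  rw [← (Measure.measurePreserving_neg (volume : Measure Space)).lintegral_comp_emb
      (MeasurableEquiv.neg Space).measurableEmbedding]
  simp [reflect]

/-- Since `ω` is even, conjugating a free wave reverses time and reflects its profile. -/
theorem fourierInv_evolve_reflect (m t : ℝ) (G : Space → ℂ) (x : Space) :
    𝓕⁻ (evolve m t (reflect G)) x = (starRingEnd ℂ) (𝓕⁻ (evolve m (-t) G) x) := by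
  rw [Real.fourierInv_eq, Real.fourierInv_eq, ← integral_conj, ← integral_neg_eq_self]
  refine integral_congr_ae (Filter.Eventually.of_forall fun η => ?_)
  simp only [evolve, reflect, omega_neg, Circle.smul_def, smul_eq_mul, map_mul, neg_neg,
    inner_neg_left, neg_mul, AddChar.map_neg_eq_inv, Circle.coe_inv_eq_conj]

/-- `reflectSign ε G` is `G` if `ε = 1` and the reflection of `G` if `ε = -1`. -/
def reflectSign (ε : ℝ) (G : Space → ℂ) : Space → ℂ := if ε = 1 then G else reflect G

/-- Plancherel returns to physical space, where only the moduli of the two waves matter, so the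
second may be conjugated. This needs all output frequencies: conjugating one factor moves the
spectrum of the product. -/
theorem lintegral_enorm_sq_conv_evolve_eq (hF : StronglyMeasurable F)
    (hG : StronglyMeasurable G) (hF1 : Integrable F) (hG1 : Integrable G)
    (hF2 : MemLp F 2 volume) (hG2 : MemLp G 2 volume) {ε : ℝ} (hε : ε = 1 ∨ ε = -1) :
    ∫⁻ t, ∫⁻ ξ, ‖conv (evolve m t F) (evolve m (ε * t) G) ξ‖ₑ ^ 2 =
      bilin m F (reflectSign ε G) := by
  refine lintegral_congr fun t => ?_
  rw [lintegral_enorm_sq_conv (integrable_evolve hF hF1) (memLp_evolve hF hF2)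
    (integrable_evolve hG hG1) (memLp_evolve hG hG2)]
  rcases hε with rfl | rfl
  · simp [reflectSign]
  · have : ((-1 : ℝ) = 1) = False := by norm_num
    simp [reflectSign, this, fourierInv_evolve_reflect]

theorem bilin_le (hF : StronglyMeasurable F) (hG : StronglyMeasurable G)
    (hF1 : Integrable F) (hG1 : Integrable G)
    (hF2 : MemLp F 2 volume) (hG2 : MemLp G 2 volume) {M : ℝ≥0∞}
    (hM : ∀ (ξ : Space) (I : Set ℝ), MeasurableSet I →
      volume {η | F η ≠ 0 ∧ G (ξ - η) ≠ 0 ∧ omega m η + omega m (ξ - η) ∈ I} ≤ M * volume I) :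
    bilin m F G ≤ M * ((∫⁻ η, ‖F η‖ₑ ^ 2) * ∫⁻ η, ‖G η‖ₑ ^ 2) := by
  have h := lintegral_enorm_sq_conv_evolve_eq (m := m) hF hG hF1 hG1 hF2 hG2 (Or.inl rfl)
  simp only [one_mul, reflectSign, if_true] at h
  rw [← h]
  exact lintegral_enorm_sq_conv_evolve_le hF hG hF2 hG2 hM

end Evolution

/-! ### One- and two-dimensional push-forward bounds, adapted coordinates. -/

section Geometry

open scoped NNReal

/-- A real function which expands distances on `S` by at least `1 / L` pulls back measures of sets
with a factor at most `L`. -/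
theorem volume_inter_preimage_le {S : Set ℝ} {g : ℝ → ℝ} {L : ℝ≥0}
    (h : ∀ a ∈ S, ∀ b ∈ S, |a - b| ≤ L * |g a - g b|) (I : Set ℝ) :
    volume (S ∩ g ⁻¹' I) ≤ L * volume I := by
  set T := S ∩ g ⁻¹' I with hT
  have hinj : Set.InjOn g T := fun a ha b hb hab => by
    have := h a ha.1 b hb.1
    rw [hab] at this
    simp only [sub_self, abs_zero, mul_zero] at this
    exact sub_eq_zero.1 (abs_nonpos_iff.1 this)
  have hinv := hinj.leftInvOn_invFunOn
  -- The inverse of `g` is `L`-Lipschitz, and Lebesgue measure on the line is one-dimensional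
  -- Hausdorff measure, which an `L`-Lipschitz map increases by at most the factor `L`.
  have hlip : LipschitzOnWith L (Function.invFunOn g T) (g '' T) := by
    refine LipschitzOnWith.of_dist_le_mul ?_
    rintro _ ⟨a, ha, rfl⟩ _ ⟨b, hb, rfl⟩
    rw [hinv ha, hinv hb]
    exact h a ha.1 b hb.1
  have himg : Function.invFunOn g T '' (g '' T) = T := hinv.image_image
  have hle := hlip.hausdorffMeasure_image_le (d := 1) zero_le_one
  rw [himg, hausdorffMeasure_real, ENNReal.rpow_one] at hle
  refine hle.trans (mul_le_mul_right (measure_mono ?_) _)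
  rintro _ ⟨a, ha, rfl⟩
  exact ha.2

/-- The push-forward of planar Lebesgue measure under `|b|²` is at most `π` times Lebesgue
measure. -/
theorem volume_sq_add_sq_mem_le {J : Set ℝ} (hJ : MeasurableSet J) :
    volume {b : Fin 2 → ℝ | b 0 ^ 2 + b 1 ^ 2 ∈ J} ≤ ENNReal.ofReal Real.pi * volume J := by
  have hmeas : MeasurableSet {p : ℝ × ℝ | p.1 ^ 2 + p.2 ^ 2 ∈ J} :=
    hJ.preimage (f := fun p : ℝ × ℝ => p.1 ^ 2 + p.2 ^ 2) (by fun_prop)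
  have h1 : volume {b : Fin 2 → ℝ | b 0 ^ 2 + b 1 ^ 2 ∈ J} =
      volume {p : ℝ × ℝ | p.1 ^ 2 + p.2 ^ 2 ∈ J} := by
    rw [← (volume_preserving_finTwoArrow ℝ).measure_preimage_equiv]
    rfl
  have hrad : ∫⁻ r in Set.Ioi (0 : ℝ), ENNReal.ofReal (2 * r) * J.indicator 1 (r ^ 2) ≤
      volume J := by
    have hcv := lintegral_image_eq_lintegral_abs_deriv_mul (s := Set.Ioi (0 : ℝ))
      (f := fun r => r ^ 2) (f' := fun r => 2 * r) measurableSet_Ioi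
      (fun r _ => by simpa using (hasDerivAt_pow 2 r).hasDerivWithinAt)
      (fun a ha b hb hab => by
        exact (sq_eq_sq₀ (le_of_lt ha) (le_of_lt hb)).1 hab) (J.indicator 1)
    calc ∫⁻ r in Set.Ioi (0 : ℝ), ENNReal.ofReal (2 * r) * J.indicator 1 (r ^ 2)
        = ∫⁻ r in Set.Ioi (0 : ℝ), ENNReal.ofReal |2 * r| * J.indicator 1 (r ^ 2) := by
          refine setLIntegral_congr_fun measurableSet_Ioi fun r hr => ?_
          have : (0 : ℝ) < r := hr
          simp only [abs_of_pos (by positivity : (0 : ℝ) < 2 * r)]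
      _ ≤ ∫⁻ q, J.indicator 1 q := hcv.symm.trans_le (setLIntegral_le_lintegral _ _)
      _ = volume J := by simp [lintegral_indicator_one hJ]
  rw [h1, ← lintegral_indicator_one hmeas, ← lintegral_comp_polarCoord_symm,
    polarCoord_target, Measure.volume_eq_prod, ← Measure.prod_restrict]
  have hcongr : ∀ p : ℝ × ℝ, ENNReal.ofReal p.1 •
      ({p : ℝ × ℝ | p.1 ^ 2 + p.2 ^ 2 ∈ J}.indicator 1 (polarCoord.symm p) : ℝ≥0∞) =
      ENNReal.ofReal p.1 * J.indicator 1 (p.1 ^ 2) := fun p => by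
    have : (p.1 * Real.cos p.2) ^ 2 + (p.1 * Real.sin p.2) ^ 2 = p.1 ^ 2 := by
      linear_combination p.1 ^ 2 * Real.cos_sq_add_sin_sq p.2
    by_cases hp : p.1 ^ 2 ∈ J
    · rw [Set.indicator_of_mem (by simpa [polarCoord_symm_apply, this] using hp),
        Set.indicator_of_mem hp]
      simp
    · rw [Set.indicator_of_notMem (by simpa [polarCoord_symm_apply, this] using hp),
        Set.indicator_of_notMem hp]
      simp
  simp only [hcongr]
  have hJi : Measurable (J.indicator (1 : ℝ → ℝ≥0∞)) := measurable_one.indicator hJ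
  rw [lintegral_prod _ (by fun_prop)]
  simp only [lintegral_const, MeasurableSet.univ, Measure.restrict_apply, Set.univ_inter,
    Real.volume_Ioo]
  -- The factor `2` of the total angle `2π` joins the polar density `r` to form `2r dr = dq` with `q
  -- = r²`; the factor `π` remains.
  have hpi : ENNReal.ofReal (Real.pi - -Real.pi) = ENNReal.ofReal Real.pi * 2 := by
    rw [sub_neg_eq_add, ENNReal.ofReal_add Real.pi_nonneg Real.pi_nonneg, mul_two]
  rw [lintegral_mul_const _ (by fun_prop), hpi, mul_comm, mul_assoc,
    ← lintegral_const_mul _ (by fun_prop)]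
  refine mul_le_mul_right (le_trans (le_of_eq ?_) hrad) _
  refine lintegral_congr fun r => ?_
  rw [ENNReal.ofReal_mul (by norm_num), mul_assoc]
  simp

/-- Cartesian coordinates whose first axis is the unit vector `e`. -/
theorem exists_coordinates {e : Space} (he : ‖e‖ = 1) :
    ∃ T : Space ≃ᵐ ℝ × (Fin 2 → ℝ), MeasurePreserving T volume volume ∧
      (∀ η, (T η).1 = inner ℝ e η) ∧
      (∀ η, ‖η‖ ^ 2 = (T η).1 ^ 2 + ((T η).2 0 ^ 2 + (T η).2 1 ^ 2)) ∧
      ∀ η ξ, T (ξ - η) = T ξ - T η := by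
  obtain ⟨b, hb⟩ := Orthonormal.exists_orthonormalBasis_extension_of_card_eq
    (𝕜 := ℝ) (E := Space) (ι := Fin 3) (by simp) (v := fun _ => e) (s := {0})
    ⟨fun i => he, fun i j hij => absurd (Subsingleton.elim i j) hij⟩
  have hb0 : b 0 = e := hb 0 rfl
  refine ⟨(b.measurableEquiv.trans (MeasurableEquiv.toLp 2 (Fin 3 → ℝ)).symm).trans
    (MeasurableEquiv.piFinSuccAbove (fun _ => ℝ) 0), ?_, ?_, ?_, ?_⟩
  · exact (volume_preserving_piFinSuccAbove (fun _ : Fin 3 => ℝ) 0).comp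
      ((PiLp.volume_preserving_ofLp (Fin 3)).comp b.measurePreserving_measurableEquiv)
  · intro η
    rw [← hb0, ← b.repr_apply_apply]
    rfl
  · intro η
    rw [← b.repr.norm_map η, EuclideanSpace.norm_sq_eq, Fin.sum_univ_three]
    simp only [Real.norm_eq_abs, sq_abs, add_assoc]
    rfl
  · intro η ξ
    have h : b.repr (ξ - η) = b.repr ξ - b.repr η := map_sub _ _ _
    refine Prod.ext ?_ (funext fun i => ?_)
    · exact congrArg (fun v : Space => v 0) h
    · exact congrArg (fun v : Space => v i.succ) h

end Geometry

/-! ### Level sets of the resonance function. -/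

section Resonance

open scoped NNReal

theorem volume_le_of_fst_sections {T : Space ≃ᵐ ℝ × (Fin 2 → ℝ)}
    (hT : MeasurePreserving T volume volume) {S : Set Space} (hS : MeasurableSet S) {B : Set ℝ}
    (hB : MeasurableSet B) {K : ℝ≥0∞} (hSB : ∀ η ∈ S, (T η).1 ∈ B)
    (hK : ∀ a, volume {b | T.symm (a, b) ∈ S} ≤ K) : volume S ≤ K * volume B := by
  rw [← hT.symm.measure_preimage_equiv, Measure.volume_eq_prod,
    Measure.prod_apply (T.symm.measurable hS)]
  calc ∫⁻ a, volume (Prod.mk a ⁻¹' (T.symm ⁻¹' S))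
      ≤ ∫⁻ a, B.indicator (fun _ => K) a := by
        refine lintegral_mono fun a => ?_
        by_cases ha : a ∈ B
        · simp only [Set.indicator_of_mem ha]
          exact hK a
        · have : Prod.mk a ⁻¹' (T.symm ⁻¹' S) = ∅ := by
            refine Set.eq_empty_of_forall_notMem fun b hb => ha ?_
            simpa using hSB _ hb
          simp [this]
    _ = K * volume B := by simp [lintegral_indicator hB]

theorem volume_le_of_snd_sections {T : Space ≃ᵐ ℝ × (Fin 2 → ℝ)}
    (hT : MeasurePreserving T volume volume) {S : Set Space} (hS : MeasurableSet S)
    {B : Set (Fin 2 → ℝ)}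
    (hB : MeasurableSet B) {K : ℝ≥0∞} (hSB : ∀ η ∈ S, (T η).2 ∈ B)
    (hK : ∀ b, volume {a | T.symm (a, b) ∈ S} ≤ K) : volume S ≤ K * volume B := by
  rw [← hT.symm.measure_preimage_equiv, Measure.volume_eq_prod,
    Measure.prod_apply_symm (T.symm.measurable hS)]
  calc ∫⁻ b, volume ((fun a => (a, b)) ⁻¹' (T.symm ⁻¹' S))
      ≤ ∫⁻ b, B.indicator (fun _ => K) b := by
        refine lintegral_mono fun b => ?_
        by_cases hb : b ∈ B
        · simp only [Set.indicator_of_mem hb]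
          exact hK b
        · have : (fun a => (a, b)) ⁻¹' (T.symm ⁻¹' S) = ∅ := by
            refine Set.eq_empty_of_forall_notMem fun a ha => hb ?_
            simpa using hSB _ ha
          simp [this]
    _ = K * volume B := by simp [lintegral_indicator hB]

/-- Factor `x - y = (√x + √y)(√x - √y)`. -/
theorem sub_le_mul_sqrt_sub_sqrt {x y N : ℝ} (hy : 0 ≤ y) (hyx : y ≤ x) (hN : √x ≤ N) :
    x - y ≤ 2 * N * (√x - √y) := by
  have h1 := Real.sqrt_le_sqrt hyx
  have h2 := Real.sq_sqrt hy
  have h3 := Real.sq_sqrt (hy.trans hyx)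
  nlinarith

theorem measurableSet_resonance (m : ℝ) (ξ : Space) {I : Set ℝ} (hI : MeasurableSet I) :
    MeasurableSet {η : Space | omega m η + omega m (ξ - η) ∈ I} := by
  have := continuous_omega m
  exact hI.preimage (f := fun η : Space => omega m η + omega m (ξ - η)) (by fun_prop)

theorem exists_unit_smul_eq (ξ : Space) : ∃ e : Space, ‖e‖ = 1 ∧ ξ = ‖ξ‖ • e := by
  by_cases h : ξ = 0
  · exact ⟨EuclideanSpace.single 0 1, by simp, by simp [h]⟩
  · have h' : ‖ξ‖ ≠ 0 := norm_ne_zero_iff.2 h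
    refine ⟨‖ξ‖⁻¹ • ξ, ?_, ?_⟩
    · rw [norm_smul, norm_inv, norm_norm, inv_mul_cancel₀ h']
    · rw [smul_smul, mul_inv_cancel₀ h', one_smul]

theorem abs_inner_sub_inner_le {e η c : Space} (he : ‖e‖ = 1) :
    |inner ℝ e η - inner ℝ e c| ≤ ‖η - c‖ := by
  rw [← inner_sub_right]
  simpa [he] using abs_real_inner_le_norm e (η - c)

/-- The resonance function `ω(η) + ω(ξ - η)` on a ball, without any transversality. -/
theorem volume_resonance_ball_le {m h Λ : ℝ} (hm : 0 ≤ m) (hΛ : 0 ≤ Λ) (c ξ : Space)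
    {I : Set ℝ} (hI : MeasurableSet I) :
    volume {η : Space | ‖η - c‖ ≤ h ∧ ‖η‖ ≤ Λ ∧ omega m η + omega m (ξ - η) ∈ I} ≤
      ENNReal.ofReal (4 * Real.pi * h * (m + Λ)) * volume I := by
  obtain ⟨e, he, hξ⟩ := exists_unit_smul_eq ξ
  obtain ⟨T, hT, hT1, hTn, -⟩ := exists_coordinates he
  set d := ‖ξ‖ with hd
  have hξη : ∀ η : Space, ‖ξ - η‖ ^ 2 = d ^ 2 - 2 * d * inner ℝ e η + ‖η‖ ^ 2 := fun η => by
    rw [norm_sub_sq_real, ← hd]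
    have : inner ℝ ξ η = d * inner ℝ e η := by
      conv_lhs => rw [hξ]
      exact real_inner_smul_left _ _ _
    rw [this]
    ring
  have hS : MeasurableSet
      {η : Space | ‖η - c‖ ≤ h ∧ ‖η‖ ≤ Λ ∧ omega m η + omega m (ξ - η) ∈ I} := by
    have h1 : MeasurableSet {η : Space | ‖η - c‖ ≤ h} := measurableSet_le (by fun_prop) (by fun_prop)
    have h2 : MeasurableSet {η : Space | ‖η‖ ≤ Λ} := measurableSet_le (by fun_prop) (by fun_prop)
    exact h1.inter (h2.inter (measurableSet_resonance m ξ hI))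
  -- The constant is the slab width `2h`, times `π` from the planar push-forward, times the inverse
  -- slope `2(m + Λ)`.
  refine (volume_le_of_fst_sections hT hS
    (B := Set.Icc (inner ℝ e c - h) (inner ℝ e c + h)) measurableSet_Icc
    (K := ENNReal.ofReal Real.pi * (ENNReal.ofReal (2 * (m + Λ)) * volume I)) ?_ ?_).trans_eq ?_
  · intro η hη
    have := abs_le.1 ((abs_inner_sub_inner_le he).trans hη.1)
    rw [hT1]
    exact ⟨by linarith, by linarith⟩
  · intro a
    -- On a plane orthogonal to `ξ`, both `|η|²` and `|ξ - η|²` are a constant plus `q = |b|²`, so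
    -- both roots increase with `q` and the first alone gives the lower bound on the slope.
    set f : ℝ → ℝ := fun q => √(m ^ 2 + (a ^ 2 + q)) + √(m ^ 2 + ((d - a) ^ 2 + q)) with hf
    set A : Set ℝ := {q | 0 ≤ q ∧ a ^ 2 + q ≤ Λ ^ 2} with hA
    have hAm : MeasurableSet (A ∩ f ⁻¹' I) := by
      have h1 : MeasurableSet {q : ℝ | a ^ 2 + q ≤ Λ ^ 2} :=
        measurableSet_le (by fun_prop) (by fun_prop)
      exact (measurableSet_Ici.inter h1).inter (hI.preimage (by fun_prop))
    have hmono : ∀ q ∈ A, ∀ q' ∈ A, q' ≤ q → |q - q'| ≤ 2 * (m + Λ) * |f q - f q'| := by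
      intro q hq q' hq' hle
      have h1 : √(m ^ 2 + (a ^ 2 + q)) ≤ m + Λ :=
        Real.sqrt_le_iff.2 ⟨by linarith, by nlinarith [hq.2]⟩
      have h2 := sub_le_mul_sqrt_sub_sqrt (x := m ^ 2 + (a ^ 2 + q)) (y := m ^ 2 + (a ^ 2 + q'))
        (by nlinarith [hq'.1, sq_nonneg m, sq_nonneg a]) (by linarith) h1
      have h3 : √(m ^ 2 + ((d - a) ^ 2 + q')) ≤ √(m ^ 2 + ((d - a) ^ 2 + q)) :=
        Real.sqrt_le_sqrt (by linarith)
      have h4 : √(m ^ 2 + (a ^ 2 + q)) - √(m ^ 2 + (a ^ 2 + q')) ≤ |f q - f q'| := by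
        refine le_trans ?_ (le_abs_self _)
        simp only [hf]
        linarith
      rw [abs_of_nonneg (by linarith)]
      nlinarith
    have hvol := volume_inter_preimage_le (S := A) (g := f) (L := (2 * (m + Λ)).toNNReal)
      (fun q hq q' hq' => by
        rw [Real.coe_toNNReal _ (by positivity)]
        rcases le_total q' q with h | h
        · exact hmono q hq q' hq' h
        · rw [abs_sub_comm, abs_sub_comm (f q)]
          exact hmono q' hq' q hq h) I
    refine le_trans (measure_mono ?_) ((volume_sq_add_sq_mem_le hAm).trans
      (mul_le_mul_right hvol _))
    intro b hb
    obtain ⟨-, hb2, hb3⟩ := hb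
    set η := T.symm (a, b) with hη
    have hTη : T η = (a, b) := by simp [hη]
    have hn : ‖η‖ ^ 2 = a ^ 2 + (b 0 ^ 2 + b 1 ^ 2) := by rw [hTn, hTη]
    have ha : inner ℝ e η = a := by rw [← hT1, hTη]
    have hn' : ‖ξ - η‖ ^ 2 = (d - a) ^ 2 + (b 0 ^ 2 + b 1 ^ 2) := by
      rw [hξη, hn, ha]
      ring
    refine ⟨⟨by positivity, ?_⟩, ?_⟩
    · rw [← hn]
      exact pow_le_pow_left₀ (norm_nonneg _) hb2 2
    · change f (b 0 ^ 2 + b 1 ^ 2) ∈ I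
      simp only [hf]
      rw [← hn, ← hn']
      exact hb3
  · rw [Real.volume_Icc, show 4 * Real.pi * h * (m + Λ) = Real.pi * (2 * (m + Λ)) * (2 * h) by ring,
      ENNReal.ofReal_mul (p := Real.pi * (2 * (m + Λ))) (by positivity),
      ENNReal.ofReal_mul (p := Real.pi) (by positivity),
      show inner ℝ e c + h - (inner ℝ e c - h) = 2 * h by ring]
    ring

/-- The resonance function `ω(η) + ω(ξ - η)` on a ball, if it is transversal to a direction. -/
theorem volume_resonance_transversal_le {m h Λ α : ℝ} (hm : 0 ≤ m) (hΛ : 0 ≤ Λ) (hα : 0 < α)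
    (hh : 0 ≤ h) {e : Space} (he : ‖e‖ = 1) (c ξ : Space) {I : Set ℝ} (hI : MeasurableSet I) :
    volume {η : Space | ‖η - c‖ ≤ h ∧ ‖η‖ ≤ Λ ∧ α ≤ inner ℝ e η ∧ inner ℝ e (ξ - η) ≤ 0 ∧
        omega m η + omega m (ξ - η) ∈ I} ≤
      ENNReal.ofReal ((2 * h) ^ 2 * ((m + Λ) / α)) * volume I := by
  obtain ⟨T, hT, hT1, hTn, hTs⟩ := exists_coordinates he
  have hS : MeasurableSet {η : Space | ‖η - c‖ ≤ h ∧ ‖η‖ ≤ Λ ∧ α ≤ inner ℝ e η ∧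
      inner ℝ e (ξ - η) ≤ 0 ∧ omega m η + omega m (ξ - η) ∈ I} := by
    have h1 : MeasurableSet {η : Space | ‖η - c‖ ≤ h} := measurableSet_le (by fun_prop) (by fun_prop)
    have h2 : MeasurableSet {η : Space | ‖η‖ ≤ Λ} := measurableSet_le (by fun_prop) (by fun_prop)
    have h3 : MeasurableSet {η : Space | α ≤ inner ℝ e η} :=
      measurableSet_le (by fun_prop) (by fun_prop)
    have h4 : MeasurableSet {η : Space | inner ℝ e (ξ - η) ≤ 0} :=
      measurableSet_le (by fun_prop) (by fun_prop)
    exact h1.inter (h2.inter (h3.inter (h4.inter (measurableSet_resonance m ξ hI))))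
  -- The set lies over a square of side `2h`; each line parallel to `e` contributes the inverse
  -- slope `(m + Λ) / α`.
  refine (volume_le_of_snd_sections hT hS
    (B := Set.Icc (fun i => (T c).2 i - h) (fun i => (T c).2 i + h)) measurableSet_Icc
    (K := ENNReal.ofReal ((m + Λ) / α) * volume I) ?_ ?_).trans_eq ?_
  · intro η hη
    have hn := hTn (η - c)
    rw [hTs] at hn
    have hsq : ‖η - c‖ ^ 2 ≤ h ^ 2 := pow_le_pow_left₀ (norm_nonneg _) hη.1 2
    have hi : ∀ i, |(T η).2 i - (T c).2 i| ≤ h := fun i => by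
      refine abs_le_of_sq_le_sq ?_ hh
      simp only [Prod.fst_sub, Prod.snd_sub, Pi.sub_apply] at hn
      fin_cases i
      · simp only [Fin.zero_eta]
        nlinarith [sq_nonneg ((T η).1 - (T c).1), sq_nonneg ((T η).2 1 - (T c).2 1)]
      · simp only [Fin.mk_one]
        nlinarith [sq_nonneg ((T η).1 - (T c).1), sq_nonneg ((T η).2 0 - (T c).2 0)]
    exact ⟨fun i => by linarith [(abs_le.1 (hi i)).1], fun i => by linarith [(abs_le.1 (hi i)).2]⟩
  · intro b
    set p := b 0 ^ 2 + b 1 ^ 2 with hp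
    set s := ((T ξ).2 0 - b 0) ^ 2 + ((T ξ).2 1 - b 1) ^ 2 with hs
    set x := (T ξ).1 with hx
    set f : ℝ → ℝ := fun a => √(m ^ 2 + (a ^ 2 + p)) + √(m ^ 2 + ((x - a) ^ 2 + s)) with hf
    set A : Set ℝ := {a | α ≤ a ∧ a ^ 2 + p ≤ Λ ^ 2 ∧ x - a ≤ 0} with hA
    have hp0 : 0 ≤ p := by positivity
    -- On `A` the first root has slope at least `α / (m + Λ)`. Since `x - a ≤ 0`, the second root
    -- also increases with `a`, so nothing cancels.
    have hmono : ∀ q ∈ A, ∀ q' ∈ A, q' ≤ q → |q - q'| ≤ (m + Λ) / α * |f q - f q'| := by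
      intro q hq q' hq' hle
      obtain ⟨hq1, hq2, hq3⟩ := hq
      obtain ⟨hq1', hq2', hq3'⟩ := hq'
      have h1 : √(m ^ 2 + (q ^ 2 + p)) ≤ m + Λ :=
        Real.sqrt_le_iff.2 ⟨by linarith, by nlinarith⟩
      have h2 := sub_le_mul_sqrt_sub_sqrt (x := m ^ 2 + (q ^ 2 + p)) (y := m ^ 2 + (q' ^ 2 + p))
        (by positivity) (by nlinarith) h1
      have h3 : √(m ^ 2 + ((x - q') ^ 2 + s)) ≤ √(m ^ 2 + ((x - q) ^ 2 + s)) :=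
        Real.sqrt_le_sqrt (by nlinarith)
      have h4 : √(m ^ 2 + (q ^ 2 + p)) - √(m ^ 2 + (q' ^ 2 + p)) ≤ |f q - f q'| := by
        refine le_trans ?_ (le_abs_self _)
        simp only [hf]
        linarith
      have h5 : (q - q') * (2 * α) ≤ 2 * (m + Λ) * |f q - f q'| := by
        refine le_trans ?_ (mul_le_mul_of_nonneg_left h4 (by positivity))
        nlinarith
      rw [abs_of_nonneg (by linarith), div_mul_eq_mul_div, le_div_iff₀ hα]
      linarith
    have hvol := volume_inter_preimage_le (S := A) (g := f) (L := ((m + Λ) / α).toNNReal)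
      (fun q hq q' hq' => by
        rw [Real.coe_toNNReal _ (by positivity)]
        rcases le_total q' q with h | h
        · exact hmono q hq q' hq' h
        · rw [abs_sub_comm, abs_sub_comm (f q)]
          exact hmono q' hq' q hq h) I
    refine le_trans (measure_mono ?_) hvol
    intro a ha
    obtain ⟨-, hb2, hb3, hb4, hb5⟩ := ha
    set η := T.symm (a, b) with hη
    have hTη : T η = (a, b) := by simp [hη]
    have hn : ‖η‖ ^ 2 = a ^ 2 + p := by rw [hTn, hTη]
    have hn' : ‖ξ - η‖ ^ 2 = (x - a) ^ 2 + s := by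
      rw [hTn, hTs, hTη]
      rfl
    rw [← hT1, hTη] at hb3
    rw [← hT1, hTs, hTη] at hb4
    refine ⟨⟨hb3, ?_, hb4⟩, ?_⟩
    · rw [← hn]
      exact pow_le_pow_left₀ (norm_nonneg _) hb2 2
    · change f a ∈ I
      simp only [hf]
      rw [← hn, ← hn']
      exact hb5
  · rw [Real.volume_Icc_pi]
    simp only [show ∀ i, (T c).2 i + h - ((T c).2 i - h) = 2 * h from fun i => by ring,
      Finset.prod_const, Finset.card_univ, Fintype.card_fin]
    rw [ENNReal.ofReal_mul (p := (2 * h) ^ 2) (by positivity),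
      ENNReal.ofReal_pow (by positivity)]
    ring

end Resonance

/-! ### Band-limited profiles and the decomposition into cubes. -/

section Cells

/-- Measurable square-integrable functions supported in the ball of radius `Λ`. -/
structure IsBandlimited (F : Space → ℂ) (Λ : ℝ) : Prop where
  stronglyMeasurable : StronglyMeasurable F
  memLp : MemLp F 2 volume
  norm_le : ∀ η, F η ≠ 0 → ‖η‖ ≤ Λ

namespace IsBandlimited

variable {F G : Space → ℂ} {Λ Λ' m : ℝ}

theorem integrable (hF : IsBandlimited F Λ) : Integrable F := by
  have hsub : Function.support F ⊆ Metric.closedBall 0 Λ := fun η hη => by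
    simpa using hF.norm_le η hη
  rw [← integrableOn_iff_integrable_of_support_subset hsub]
  have : IsFiniteMeasure (volume.restrict (Metric.closedBall (0 : Space) Λ)) :=
    ⟨by simpa using measure_closedBall_lt_top (μ := (volume : Measure Space)) (x := 0) (r := Λ)⟩
  exact (hF.memLp.restrict _).integrable (by norm_num)

theorem indicator (hF : IsBandlimited F Λ) {S : Set Space} (hS : MeasurableSet S) :
    IsBandlimited (S.indicator F) Λ where
  stronglyMeasurable := hF.stronglyMeasurable.indicator hS
  memLp := hF.memLp.indicator hS
  norm_le η h := hF.norm_le η (Set.indicator_apply_ne_zero.1 h).2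

theorem reflectSign (hF : IsBandlimited F Λ) (ε : ℝ) :
    IsBandlimited (KleinGordon.reflectSign ε F) Λ := by
  unfold KleinGordon.reflectSign
  split_ifs
  · exact hF
  · exact ⟨stronglyMeasurable_reflect hF.stronglyMeasurable, memLp_reflect hF.memLp, fun η h => by
      simpa using hF.norm_le (-η) (by simpa [reflect] using h)⟩

theorem bilin_le (hF : IsBandlimited F Λ) (hG : IsBandlimited G Λ') {M : ℝ≥0∞}
    (hM : ∀ (ξ : Space) (I : Set ℝ), MeasurableSet I →
      volume {η | F η ≠ 0 ∧ G (ξ - η) ≠ 0 ∧ omega m η + omega m (ξ - η) ∈ I} ≤ M * volume I) :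
    bilin m F G ≤ M * ((∫⁻ η, ‖F η‖ₑ ^ 2) * ∫⁻ η, ‖G η‖ₑ ^ 2) :=
  KleinGordon.bilin_le hF.stronglyMeasurable hG.stronglyMeasurable hF.integrable hG.integrable
    hF.memLp hG.memLp hM

/-- The product of two free waves, one of which has its frequencies in a ball. -/
theorem bilin_le_of_ball (hm : 0 ≤ m) (hΛ : 0 ≤ Λ) (hF : IsBandlimited F Λ)
    (hG : IsBandlimited G Λ') {h : ℝ} (hball : ∀ η η', F η ≠ 0 → F η' ≠ 0 → ‖η - η'‖ ≤ h) :
    bilin m F G ≤ ENNReal.ofReal (4 * Real.pi * h * (m + Λ)) *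
      ((∫⁻ η, ‖F η‖ₑ ^ 2) * ∫⁻ η, ‖G η‖ₑ ^ 2) := by
  refine hF.bilin_le hG fun ξ I hI => ?_
  by_cases hex : ∃ c, F c ≠ 0
  · obtain ⟨c, hc⟩ := hex
    refine le_trans (measure_mono fun η hη => ?_) (volume_resonance_ball_le hm hΛ c ξ hI)
    exact ⟨hball η c hη.1 hc, hF.norm_le η hη.1, hη.2.2⟩
  · push Not at hex
    simp [hex]

/-- The product of two free waves with nearly opposite frequencies. -/
theorem bilin_le_of_transversal (hm : 0 ≤ m) (hΛ : 0 ≤ Λ) (hF : IsBandlimited F Λ)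
    (hG : IsBandlimited G Λ') {h ℓ : ℝ} (hh : 0 ≤ h) (hℓ : 0 < ℓ) (hhℓ : 10 * h ≤ ℓ)
    (hlow : ∀ η, F η ≠ 0 → ℓ ≤ ‖η‖)
    (hball : ∀ η η', F η ≠ 0 → F η' ≠ 0 → ‖η - η'‖ ≤ h)
    (hopp : ∀ η ζ, F η ≠ 0 → G ζ ≠ 0 → ‖η + ζ‖ ≤ 5 * h) :
    bilin m F G ≤ ENNReal.ofReal ((2 * h) ^ 2 * ((m + Λ) / (ℓ / 2))) *
      ((∫⁻ η, ‖F η‖ₑ ^ 2) * ∫⁻ η, ‖G η‖ₑ ^ 2) := by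
  refine hF.bilin_le hG fun ξ I hI => ?_
  by_cases hex : ∃ c, F c ≠ 0
  · obtain ⟨c, hc⟩ := hex
    obtain ⟨e, he, hce⟩ := exists_unit_smul_eq c
    have hec : inner ℝ e c = ‖c‖ := by
      conv_lhs => rw [hce, real_inner_smul_right, real_inner_self_eq_norm_sq, he]
      simp
    have hcℓ := hlow c hc
    refine le_trans (measure_mono fun η hη => ?_)
      (volume_resonance_transversal_le hm hΛ (half_pos hℓ) hh he c ξ hI)
    -- Here `e` is the direction of a point `c` of the support of `F`: `⟨e, η⟩ ≥ |c| - h ≥ ℓ/2`, and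
    -- `⟨e, ξ - η⟩ ≤ 5h - |c| ≤ 0`.
    refine ⟨hball η c hη.1 hc, hF.norm_le η hη.1, ?_, ?_, hη.2.2⟩
    · have := abs_le.1 ((abs_inner_sub_inner_le (η := η) (c := c) he).trans (hball η c hη.1 hc))
      linarith
    · have h1 := (real_inner_le_norm e (c + (ξ - η))).trans_eq (by rw [he, one_mul])
      rw [inner_add_right, hec] at h1
      have := hopp c (ξ - η) hc hη.2.1
      linarith
  · push Not at hex
    simp [hex]

end IsBandlimited

/-- The index of the cell of the grid of side `h` which contains `η`. -/
def cell (h : ℝ) (η : Space) (i : Fin 3) : ℤ := ⌊η i / h⌋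

theorem measurable_cell (h : ℝ) : Measurable (cell h) := by
  refine measurable_pi_lambda _ fun i => Int.measurable_floor.comp ?_
  fun_prop

/-- The restriction of `F` to a cell of the grid of side `h`. -/
def cut (h : ℝ) (k : Fin 3 → ℤ) (F : Space → ℂ) : Space → ℂ := (cell h ⁻¹' {k}).indicator F

theorem measurableSet_cell (h : ℝ) (k : Fin 3 → ℤ) : MeasurableSet (cell h ⁻¹' {k}) :=
  measurable_cell h (measurableSet_singleton k)

theorem IsBandlimited.cut {F : Space → ℂ} {Λ : ℝ} (hF : IsBandlimited F Λ) (h : ℝ)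
    (k : Fin 3 → ℤ) : IsBandlimited (cut h k F) Λ :=
  hF.indicator (measurableSet_cell h k)

theorem cut_apply (h : ℝ) (k : Fin 3 → ℤ) (F : Space → ℂ) (η : Space) :
    cut h k F η = if k = cell h η then F η else 0 := by
  by_cases hk : cell h η = k
  · simp [cut, hk]
  · have : k ≠ cell h η := fun h => hk h.symm
    simp [cut, hk, this]

theorem cut_ne_zero {h : ℝ} {k : Fin 3 → ℤ} {F : Space → ℂ} {η : Space}
    (hη : cut h k F η ≠ 0) : cell h η = k ∧ F η ≠ 0 := by
  rw [cut_apply] at hη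
  split_ifs at hη with hk
  exacts [⟨hk.symm, hη⟩, absurd rfl hη]

theorem norm_le_two_mul {v : Space} {b : ℝ} (hb : 0 ≤ b) (hv : ∀ i, |v i| ≤ b) : ‖v‖ ≤ 2 * b := by
  refine abs_le_of_sq_le_sq' ?_ (by positivity) |>.2
  have : ∀ i, v i ^ 2 ≤ b ^ 2 := fun i => sq_le_sq' (abs_le.1 (hv i)).1 (abs_le.1 (hv i)).2
  rw [EuclideanSpace.norm_sq_eq, Fin.sum_univ_three]
  simp only [Real.norm_eq_abs, sq_abs]
  nlinarith [this 0, this 1, this 2]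

theorem cell_bounds {h : ℝ} (hh : 0 < h) (η : Space) (i : Fin 3) :
    cell h η i * h ≤ η i ∧ η i < (cell h η i + 1) * h :=
  ⟨(le_div_iff₀ hh).1 (Int.floor_le _), (div_lt_iff₀ hh).1 (Int.lt_floor_add_one _)⟩

theorem norm_sub_le_of_cell_eq {h : ℝ} (hh : 0 < h) {η η' : Space} (he : cell h η = cell h η') :
    ‖η - η'‖ ≤ 2 * h := by
  refine norm_le_two_mul hh.le fun i => ?_
  have h1 := cell_bounds hh η i
  have h2 := cell_bounds hh η' i
  rw [he] at h1
  rw [PiLp.sub_apply]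
  exact abs_le.2 ⟨by linarith, by linarith⟩

/-- The finite set of the indices `n` with entries between `-3` and `3`. -/
def nearIndices : Finset (Fin 3 → ℤ) := Fintype.piFinset fun _ => Finset.Icc (-3) 3

/-- If `n` is the sum of the two indices, each coordinate of `η + ζ` lies in `[n h, (n + 2) h)`,
hence is at most `5h` in modulus. -/
theorem norm_add_le_of_cell_add {h : ℝ} (hh : 0 < h) {η ζ : Space}
    (hn : cell h η + cell h ζ ∈ nearIndices) : ‖η + ζ‖ ≤ 10 * h := by
  rw [show 10 * h = 2 * (5 * h) by ring]
  refine norm_le_two_mul (by positivity) fun i => ?_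
  have h1 := cell_bounds hh η i
  have h2 := cell_bounds hh ζ i
  have h3 := Finset.mem_Icc.1 (Fintype.mem_piFinset.1 hn i)
  rw [Pi.add_apply] at h3
  have h4 : (-3 : ℝ) ≤ cell h η i + cell h ζ i := by exact_mod_cast h3.1
  have h5 : (cell h η i + cell h ζ i : ℝ) ≤ 3 := by exact_mod_cast h3.2
  rw [PiLp.add_apply]
  exact abs_le.2 ⟨by nlinarith, by nlinarith⟩

theorem abs_apply_le_norm (v : Space) (i : Fin 3) : |v i| ≤ ‖v‖ := by
  simpa using PiLp.norm_apply_le v i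

theorem cell_add_cell_mem {h : ℝ} (hh : 0 < h) {η ξ : Space} (hξ : ‖ξ‖ ≤ h) :
    cell h η + cell h (ξ - η) ∈ nearIndices := by
  refine Fintype.mem_piFinset.2 fun i => Finset.mem_Icc.2 ?_
  have h1 := cell_bounds hh η i
  have h2 := cell_bounds hh (ξ - η) i
  have h3 := abs_le.1 ((abs_apply_le_norm ξ i).trans hξ)
  rw [PiLp.sub_apply] at h2
  rw [Pi.add_apply]
  have h4 : (cell h η i + cell h (ξ - η) i : ℝ) ≤ 3 := by
    by_contra! hc
    nlinarith
  have h5 : (-3 : ℝ) ≤ cell h η i + cell h (ξ - η) i := by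
    by_contra! hc
    nlinarith
  exact ⟨by exact_mod_cast h5, by exact_mod_cast h4⟩

/-- A finite set of indices of cells which cover the ball of radius `Λ`. -/
def ballIndices (h Λ : ℝ) : Finset (Fin 3 → ℤ) :=
  Fintype.piFinset fun _ => Finset.Icc ⌊-Λ / h⌋ ⌊Λ / h⌋

theorem cell_mem_ballIndices {h Λ : ℝ} (hh : 0 < h) {η : Space} (hη : ‖η‖ ≤ Λ) :
    cell h η ∈ ballIndices h Λ := by
  have h3 := fun i => abs_le.1 ((abs_apply_le_norm η i).trans hη)
  exact Fintype.mem_piFinset.2 fun i => Finset.mem_Icc.2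
    ⟨Int.floor_le_floor (div_le_div_of_nonneg_right (h3 i).1 hh.le),
      Int.floor_le_floor (div_le_div_of_nonneg_right (h3 i).2 hh.le)⟩

theorem sum_lintegral_cut_le {F : Space → ℂ} (hF : StronglyMeasurable F) (h : ℝ)
    (S : Finset (Fin 3 → ℤ)) :
    ∑ k ∈ S, ∫⁻ η, ‖cut h k F η‖ₑ ^ 2 ≤ ∫⁻ η, ‖F η‖ₑ ^ 2 := by
  rw [← lintegral_finsetSum]
  · refine lintegral_mono fun η => ?_
    calc ∑ k ∈ S, ‖cut h k F η‖ₑ ^ 2 = ∑ k ∈ S, if k = cell h η then ‖F η‖ₑ ^ 2 else 0 := by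
          refine Finset.sum_congr rfl fun k _ => ?_
          rw [cut_apply]
          split_ifs <;> simp
      _ ≤ ‖F η‖ₑ ^ 2 := by
          rw [Finset.sum_ite_eq']
          split_ifs <;> simp
  · exact fun k _ => ((hF.indicator (measurableSet_cell h k)).enorm.pow_const 2)

/-- Each `η` in the support of `F` is counted once: `k` is the cell of `η`, and `n` is the sum of
the cells of `η` and `ξ - η`, which is near zero because `|ξ| ≤ h`. -/
theorem conv_eq_sum_cut {F G : Space → ℂ} {Λ Λ' m h : ℝ} (t s : ℝ) (hF : IsBandlimited F Λ)
    (hG : IsBandlimited G Λ') (hh : 0 < h) {ξ : Space} (hξ : ‖ξ‖ ≤ h) :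
    conv (evolve m t F) (evolve m s G) ξ =
      ∑ n ∈ nearIndices, ∑ k ∈ ballIndices h Λ,
        conv (evolve m t (cut h k F)) (evolve m s (cut h (n - k) G)) ξ := by
  have hint : ∀ n k, Integrable fun η => evolve m t (cut h k F) η *
      evolve m s (cut h (n - k) G) (ξ - η) := fun n k =>
    integrable_mul_comp_sub (memLp_evolve (hF.cut h k).stronglyMeasurable (hF.cut h k).memLp)
      (memLp_evolve (hG.cut h _).stronglyMeasurable (hG.cut h _).memLp) ξ
  simp only [conv]
  simp_rw [← integral_finsetSum _ (fun k _ => hint _ k)]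
  rw [← integral_finsetSum _ (fun n _ => integrable_finsetSum _ fun k _ => hint n k)]
  refine integral_congr_ae (Filter.Eventually.of_forall fun η => ?_)
  by_cases hη : F η = 0
  · have : ∀ k, cut h k F η = 0 := fun k => by rw [cut_apply, hη, ite_self]
    simp [evolve, this, hη]
  · have hk := cell_mem_ballIndices hh (hF.norm_le η hη)
    have hn := cell_add_cell_mem hh (η := η) hξ
    have hinner : ∀ n, ∑ k ∈ ballIndices h Λ, evolve m t (cut h k F) η *
        evolve m s (cut h (n - k) G) (ξ - η) =
        if n = cell h η + cell h (ξ - η) then evolve m t F η * evolve m s G (ξ - η) else 0 := by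
      intro n
      rw [Finset.sum_eq_single_of_mem _ hk]
      · simp only [evolve, cut_apply, if_true, sub_eq_iff_eq_add, add_comm (cell h (ξ - η))]
        split_ifs <;> simp
      · intro k _ hkne
        simp [evolve, cut_apply, hkne]
    simp only [hinner]
    rw [Finset.sum_ite_eq', if_pos hn]

theorem sq_sum_mul_le {ι : Type*} (S : Finset ι) (a b : ι → ℝ≥0∞) :
    (∑ k ∈ S, a k * b k) ^ 2 ≤ (∑ k ∈ S, a k ^ 2) * ∑ k ∈ S, b k ^ 2 := by
  have h := ENNReal.inner_le_Lp_mul_Lq S a b (p := 2) (q := 2)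
    (Real.holderConjugate_iff.2 ⟨by norm_num, by norm_num⟩)
  refine (pow_le_pow_left' h 2).trans_eq ?_
  rw [mul_pow, ← ENNReal.rpow_natCast, ← ENNReal.rpow_mul, ← ENNReal.rpow_natCast,
    ← ENNReal.rpow_mul]
  norm_num

theorem eLpNorm_sq_prod {u : ℝ × Space → ℂ} (hu : StronglyMeasurable u) :
    eLpNorm u 2 volume ^ 2 = ∫⁻ t, ∫⁻ x, ‖u (t, x)‖ₑ ^ 2 := by
  rw [← lintegral_enorm_sq_eq_eLpNorm_sq, Measure.volume_eq_prod,
    lintegral_prod _ (hu.enorm.pow_const 2).aemeasurable]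

/-- The interaction on the Fourier side. -/
def waveConv (m ε : ℝ) (F G : Space → ℂ) (p : ℝ × Space) : ℂ :=
  conv (evolve m p.1 F) (evolve m (ε * p.1) G) p.2

theorem eLpNorm_waveConv_sq {F G : Space → ℂ} {Λ Λ' m ε : ℝ} (hF : IsBandlimited F Λ)
    (hG : IsBandlimited G Λ') (hε : ε = 1 ∨ ε = -1) :
    eLpNorm (waveConv m ε F G) 2 volume ^ 2 = bilin m F (reflectSign ε G) := by
  rw [eLpNorm_sq_prod (u := waveConv m ε F G)
    (stronglyMeasurable_conv_evolve ε hF.stronglyMeasurable hG.stronglyMeasurable)]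
  exact lintegral_enorm_sq_conv_evolve_eq hF.stronglyMeasurable hG.stronglyMeasurable
    hF.integrable hG.integrable hF.memLp hG.memLp hε

theorem lintegral_enorm_sq_reflectSign (ε : ℝ) (G : Space → ℂ) :
    ∫⁻ η, ‖reflectSign ε G η‖ₑ ^ 2 = ∫⁻ η, ‖G η‖ₑ ^ 2 := by
  unfold reflectSign
  split_ifs
  exacts [rfl, lintegral_enorm_sq_reflect G]

theorem eLpNorm_waveConv_le {F G : Space → ℂ} {Λ Λ' m ε : ℝ} {N : ℝ≥0∞}
    (hF : IsBandlimited F Λ) (hG : IsBandlimited G Λ') (hε : ε = 1 ∨ ε = -1)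
    (hN : bilin m F (reflectSign ε G) ≤
      N ^ 2 * ((∫⁻ η, ‖F η‖ₑ ^ 2) * ∫⁻ η, ‖reflectSign ε G η‖ₑ ^ 2)) :
    eLpNorm (waveConv m ε F G) 2 volume ≤ N * (eLpNorm F 2 volume * eLpNorm G 2 volume) := by
  rw [← eLpNorm_waveConv_sq hF hG hε, lintegral_enorm_sq_reflectSign,
    lintegral_enorm_sq_eq_eLpNorm_sq, lintegral_enorm_sq_eq_eLpNorm_sq,
    ← mul_pow, ← mul_pow] at hN
  exact (ENNReal.pow_le_pow_left_iff two_ne_zero).1 hN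

/-- Once the cut-off `|ξ| ≤ h` has selected the `7³ = 343` values of `n`, it is dropped. For fixed
`n` each cell of `F` meets a single cell of `G`, so the triangle inequality and Cauchy-Schwarz in
`k` sum the pieces without loss. -/
theorem eLpNorm_indicator_waveConv_le_of_cells {F G : Space → ℂ} {Λ Λ' m ε h : ℝ} {N : ℝ≥0∞}
    (hF : IsBandlimited F Λ) (hG : IsBandlimited G Λ') (hε : ε = 1 ∨ ε = -1) (hh : 0 < h)
    (hN : ∀ k, ∀ n ∈ nearIndices, bilin m (cut h k F) (reflectSign ε (cut h (n - k) G)) ≤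
      N ^ 2 * ((∫⁻ η, ‖cut h k F η‖ₑ ^ 2) * ∫⁻ η, ‖reflectSign ε (cut h (n - k) G) η‖ₑ ^ 2)) :
    eLpNorm ({p : ℝ × Space | ‖p.2‖ ≤ h}.indicator (waveConv m ε F G)) 2 volume ≤
      343 * N * (eLpNorm F 2 volume * eLpNorm G 2 volume) := by
  have hsm : ∀ n k, AEStronglyMeasurable (waveConv m ε (cut h k F) (cut h (n - k) G)) volume :=
    fun n k => (stronglyMeasurable_conv_evolve ε (hF.cut h k).stronglyMeasurable
      (hG.cut h (n - k)).stronglyMeasurable).aestronglyMeasurable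
  have hpt : ∀ p, ‖{p : ℝ × Space | ‖p.2‖ ≤ h}.indicator (waveConv m ε F G) p‖ ≤
      ‖(∑ n ∈ nearIndices, ∑ k ∈ ballIndices h Λ,
        waveConv m ε (cut h k F) (cut h (n - k) G)) p‖ := fun p => by
    by_cases hp : ‖p.2‖ ≤ h
    · rw [Set.indicator_of_mem (by exact hp), waveConv, conv_eq_sum_cut _ _ hF hG hh hp]
      simp [Finset.sum_apply, waveConv]
    · rw [Set.indicator_of_notMem (by exact hp)]
      simp
  have hk : ∀ n ∈ nearIndices, eLpNorm (∑ k ∈ ballIndices h Λ,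
      waveConv m ε (cut h k F) (cut h (n - k) G)) 2 volume ≤
        N * (eLpNorm F 2 volume * eLpNorm G 2 volume) := by
    intro n hn
    calc eLpNorm (∑ k ∈ ballIndices h Λ, waveConv m ε (cut h k F) (cut h (n - k) G)) 2 volume
        ≤ ∑ k ∈ ballIndices h Λ,
            eLpNorm (waveConv m ε (cut h k F) (cut h (n - k) G)) 2 volume :=
          eLpNorm_sum_le (fun k _ => hsm n k) (by norm_num)
      _ ≤ ∑ k ∈ ballIndices h Λ,
            N * (eLpNorm (cut h k F) 2 volume * eLpNorm (cut h (n - k) G) 2 volume) :=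
          Finset.sum_le_sum fun k _ =>
            eLpNorm_waveConv_le (hF.cut h k) (hG.cut h (n - k)) hε (hN k n hn)
      _ = N * ∑ k ∈ ballIndices h Λ,
            eLpNorm (cut h k F) 2 volume * eLpNorm (cut h (n - k) G) 2 volume := by
          rw [Finset.mul_sum]
      _ ≤ N * (eLpNorm F 2 volume * eLpNorm G 2 volume) := by
          refine mul_le_mul_right ((ENNReal.pow_le_pow_left_iff two_ne_zero).1 ?_) _
          refine (sq_sum_mul_le _ _ _).trans ?_
          rw [mul_pow]
          simp only [← lintegral_enorm_sq_eq_eLpNorm_sq]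
          refine mul_le_mul' (sum_lintegral_cut_le hF.stronglyMeasurable h _) ?_
          refine le_trans (le_of_eq ?_) (sum_lintegral_cut_le hG.stronglyMeasurable h
            ((ballIndices h Λ).image fun k => n - k))
          rw [Finset.sum_image fun a _ b _ hab => sub_right_injective hab]
  calc eLpNorm ({p : ℝ × Space | ‖p.2‖ ≤ h}.indicator (waveConv m ε F G)) 2 volume
      ≤ eLpNorm (∑ n ∈ nearIndices, ∑ k ∈ ballIndices h Λ,
          waveConv m ε (cut h k F) (cut h (n - k) G)) 2 volume := eLpNorm_mono hpt
    _ ≤ ∑ n ∈ nearIndices, eLpNorm (∑ k ∈ ballIndices h Λ,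
          waveConv m ε (cut h k F) (cut h (n - k) G)) 2 volume :=
        eLpNorm_sum_le (fun n _ => Finset.aestronglyMeasurable_sum _ fun k _ => hsm n k)
          (by norm_num)
    _ ≤ ∑ n ∈ nearIndices, N * (eLpNorm F 2 volume * eLpNorm G 2 volume) :=
        Finset.sum_le_sum hk
    _ = 343 * N * (eLpNorm F 2 volume * eLpNorm G 2 volume) := by
        rw [Finset.sum_const, nearIndices, Fintype.card_piFinset]
        simp [mul_assoc]

end Cells

/-! ### Supports of the symbols and frequency-localized data. -/

section Symbols

theorem Cutoff.eq_zero_of_two_le (χ : Cutoff) {s : ℝ} (hs : 2 ≤ |s|) : χ.toFun s = 0 := by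
  by_contra h
  have := χ.tsupport_subset (subset_tsupport _ h)
  exact absurd (abs_lt.2 this) (not_lt.2 hs)

theorem Cutoff.abs_lt_of_rho_ne_zero (χ : Cutoff) {lam s : ℝ} (hlam : 1 ≤ lam)
    (h : χ.rho lam s ≠ 0) : |s| < 2 * lam := by
  by_contra! hs
  have hpos : 0 < lam := by linarith
  refine h ?_
  unfold Cutoff.rho
  split_ifs with h1 h2
  · rfl
  · exact χ.eq_zero_of_two_le (by linarith)
  · rw [χ.eq_zero_of_two_le (s := s / lam), χ.eq_zero_of_two_le (s := 2 * s / lam), sub_zero]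
    · rw [abs_div, abs_of_pos hpos, abs_mul, le_div_iff₀ hpos, abs_of_pos (zero_lt_two' ℝ)]
      linarith
    · rwa [abs_div, abs_of_pos hpos, le_div_iff₀ hpos]

/-- Both cut-offs equal `1` for `|s| ≤ λ/2` and cancel. At `λ = 1` there is no subtraction and low
frequencies survive. -/
theorem Cutoff.lt_abs_of_rho_ne_zero (χ : Cutoff) {lam s : ℝ} (hlam : 1 < lam)
    (h : χ.rho lam s ≠ 0) : lam / 2 < |s| := by
  by_contra! hs
  have hpos : 0 < lam := by linarith
  refine h ?_
  unfold Cutoff.rho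
  rw [if_neg (by linarith), if_neg (by linarith), χ.eq_one, χ.eq_one, sub_self]
  · rw [abs_div, abs_of_pos hpos, abs_mul, div_le_one hpos, abs_of_pos (zero_lt_two' ℝ)]
    linarith
  · rw [abs_div, abs_of_pos hpos, div_le_one hpos]
    linarith

theorem Cutoff.exists_uniform_rho_bound (χ : Cutoff) :
    ∃ C, 0 < C ∧ ∀ lam s, |χ.rho lam s| ≤ C := by
  obtain ⟨C, hC⟩ := χ.hasCompactSupport.exists_bound_of_continuous χ.contDiff.continuous
  have hC0 : 0 ≤ C := (norm_nonneg _).trans (hC 0)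
  refine ⟨C + C + 1, by linarith, fun lam s => ?_⟩
  unfold Cutoff.rho
  split_ifs
  · rw [abs_zero]
    linarith
  · have := hC s
    rw [Real.norm_eq_abs] at this
    linarith
  · have h1 := hC (s / lam)
    have h2 := hC (2 * s / lam)
    rw [Real.norm_eq_abs] at h1 h2
    linarith [abs_sub (χ.toFun (s / lam)) (χ.toFun (2 * s / lam))]

theorem norm_le_of_projSymbol_ne_zero (χ : Cutoff) {lam : ℝ} (hlam : 1 ≤ lam) {ξ : Space}
    (h : projSymbol χ lam ξ ≠ 0) : ‖ξ‖ ≤ lam / Real.pi := by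
  have := χ.abs_lt_of_rho_ne_zero hlam (Complex.ofReal_ne_zero.1 h)
  rw [abs_of_nonneg (by positivity)] at this
  rw [le_div_iff₀ Real.pi_pos]
  linarith

theorem le_norm_of_projSymbol_ne_zero (χ : Cutoff) {lam : ℝ} (hlam : 1 < lam) {ξ : Space}
    (h : projSymbol χ lam ξ ≠ 0) : lam / (4 * Real.pi) ≤ ‖ξ‖ := by
  have := χ.lt_abs_of_rho_ne_zero hlam (Complex.ofReal_ne_zero.1 h)
  rw [abs_of_nonneg (by positivity)] at this
  rw [div_le_iff₀ (by positivity)]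
  linarith

theorem continuous_projSymbol (χ : Cutoff) (lam : ℝ) : Continuous (projSymbol χ lam) := by
  have := χ.continuous_rho lam
  unfold projSymbol
  fun_prop

/-- Rescaling frequencies by `2π` turns the mass `m` into `m / (2π)`. -/
theorem waveSymbol_eq (m t : ℝ) (ξ : Space) :
    waveSymbol m t ξ = Real.fourierChar (-(t * omega (m / (2 * Real.pi)) ξ)) := by
  have h : japanese m (2 * Real.pi * ‖ξ‖) = 2 * Real.pi * omega (m / (2 * Real.pi)) ξ := by
    unfold omega japanese
    rw [← Real.sqrt_sq (by positivity : 0 ≤ 2 * Real.pi), ← Real.sqrt_mul (by positivity),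
      Real.sqrt_sq (by positivity)]
    congr 1
    field_simp
  rw [waveSymbol, Real.fourierChar_apply, h]
  congr 2
  push_cast
  ring

/-- The Fourier transform of a frequency-localized function, and the free evolution of the
latter as a Fourier integral. -/
theorem exists_fourier_of_proj (χ : Cutoff) (m : ℝ) {lam : ℝ} (hlam : 1 ≤ lam) (f : L2) :
    ∃ F : Space → ℂ, IsBandlimited F (lam / Real.pi) ∧
      (1 < lam → ∀ η, F η ≠ 0 → lam / (4 * Real.pi) ≤ ‖η‖) ∧
      eLpNorm F 2 volume = ENNReal.ofReal ‖proj χ lam f‖ ∧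
      ∀ t, propagator m t (proj χ lam f) =ᵐ[volume] 𝓕⁻ (evolve (m / (2 * Real.pi)) t F) := by
  set Ff : L2 := 𝓕 (proj χ lam f) with hFf
  -- Restricting the representative to `S` makes its support condition hold at every point rather
  -- than almost everywhere.
  set S : Set Space := {ξ | projSymbol χ lam ξ ≠ 0} with hS
  have hSm : MeasurableSet S :=
    (continuous_projSymbol χ lam).measurable (measurableSet_singleton 0).compl
  have hae : S.indicator Ff =ᵐ[volume] Ff := by
    have h1 : Ff = ((memLp_projSymbol χ lam).toLp _ • 𝓕 f : L2) := by
      rw [hFf, proj, multiplier, FourierTransform.fourier_fourierInv_eq]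
    rw [h1]
    filter_upwards [Lp.coeFn_lpSMul (r := 2) ((memLp_projSymbol χ lam).toLp _) (𝓕 f : L2),
      (memLp_projSymbol χ lam).coeFn_toLp] with ξ h2 h3
    by_cases hξ : ξ ∈ S
    · rw [Set.indicator_of_mem hξ]
    · have h4 : projSymbol χ lam ξ = 0 := not_not.1 hξ
      rw [Set.indicator_of_notMem hξ, h2, Pi.smul_apply', h3, h4, zero_smul]
  have hF : IsBandlimited (S.indicator Ff) (lam / Real.pi) :=
    { stronglyMeasurable := (Lp.stronglyMeasurable Ff).indicator hSm
      memLp := (Lp.memLp Ff).indicator hSm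
      norm_le := fun η h =>
        norm_le_of_projSymbol_ne_zero χ hlam (Set.indicator_apply_ne_zero.1 h).1 }
  refine ⟨S.indicator Ff, hF, fun h1 η h => ?_, ?_, fun t => ?_⟩
  · exact le_norm_of_projSymbol_ne_zero χ h1 (Set.indicator_apply_ne_zero.1 h).1
  · rw [eLpNorm_congr_ae hae, ← Lp.enorm_def, ← ofReal_norm, hFf, Lp.norm_fourier_eq]
  · have hev := memLp_evolve (m := m / (2 * Real.pi)) (t := t) hF.stronglyMeasurable hF.memLp
    have h1 : propagator m t (proj χ lam f) = 𝓕⁻ (hev.toLp _ : L2) := by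
      rw [propagator, multiplier]
      congr 1
      refine Lp.ext ?_
      filter_upwards [Lp.coeFn_lpSMul (r := 2) ((memLp_waveSymbol m t).toLp _) Ff,
        (memLp_waveSymbol m t).coeFn_toLp, hev.coeFn_toLp, hae] with ξ h2 h3 h4 h5
      rw [h2, Pi.smul_apply', h3, h4, waveSymbol_eq, smul_eq_mul, evolve, h5]
    rw [h1]
    exact fourierInv_toLp_ae_eq (integrable_evolve hF.stronglyMeasurable hF.integrable) hev

end Symbols

/-! ### The interaction as an inverse Fourier integral. -/

section Interaction

variable {χ : Cutoff} {m mu ε : ℝ} {f g : L2} {F G : Space → ℂ} {Λ Λ' : ℝ}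

theorem interaction_eq (hF : IsBandlimited F Λ) (hG : IsBandlimited G Λ')
    (hf : ∀ t, propagator m t f =ᵐ[volume] 𝓕⁻ (evolve (m / (2 * Real.pi)) t F))
    (hg : ∀ t, propagator m t g =ᵐ[volume] 𝓕⁻ (evolve (m / (2 * Real.pi)) t G))
    (t : ℝ) (x : Space) :
    interaction χ m mu ε f g (t, x) =
      𝓕⁻ (fun ξ => projSymbol χ mu ξ * waveConv (m / (2 * Real.pi)) ε F G (t, ξ)) x := by
  unfold interaction projFun
  refine Real.fourierInv_congr_ae ?_ x
  have h1 := fourier_fourierInv_mul_ae_eq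
    (integrable_evolve (m := m / (2 * Real.pi)) (t := t) hF.stronglyMeasurable hF.integrable)
    (memLp_evolve hF.stronglyMeasurable hF.memLp)
    (integrable_evolve (m := m / (2 * Real.pi)) (t := ε * t) hG.stronglyMeasurable hG.integrable)
    (memLp_evolve hG.stronglyMeasurable hG.memLp)
  filter_upwards [h1] with ξ hξ
  have h2 : (fun x => propagator m t f x * propagator m (ε * t) g x) =ᵐ[volume]
      𝓕⁻ (evolve (m / (2 * Real.pi)) t F) * 𝓕⁻ (evolve (m / (2 * Real.pi)) (ε * t) G) := by
    filter_upwards [hf t, hg (ε * t)] with y h3 h4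
    rw [h3, h4, Pi.mul_apply]
  rw [Real.fourier_congr_ae h2, hξ]
  rfl

theorem stronglyMeasurable_projSymbol_mul_waveConv (hF : IsBandlimited F Λ)
    (hG : IsBandlimited G Λ') :
    StronglyMeasurable fun p : ℝ × Space => projSymbol χ mu p.2 * waveConv m ε F G p :=
  ((continuous_projSymbol χ mu).comp continuous_snd).stronglyMeasurable.mul
    (stronglyMeasurable_conv_evolve ε hF.stronglyMeasurable hG.stronglyMeasurable)

/-- The propagator gives a separate almost-everywhere class for each `t`; joint measurability comes
from the formula for the interaction valid at every `(t, x)`. -/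
theorem stronglyMeasurable_interaction (hF : IsBandlimited F Λ) (hG : IsBandlimited G Λ')
    (hf : ∀ t, propagator m t f =ᵐ[volume] 𝓕⁻ (evolve (m / (2 * Real.pi)) t F))
    (hg : ∀ t, propagator m t g =ᵐ[volume] 𝓕⁻ (evolve (m / (2 * Real.pi)) t G)) :
    StronglyMeasurable (interaction χ m mu ε f g) := by
  have h : interaction χ m mu ε f g = fun p : ℝ × Space => ∫ ξ : Space,
      (Real.fourierChar (inner ℝ ξ p.2) : ℂ) * (projSymbol χ mu ξ *
        waveConv (m / (2 * Real.pi)) ε F G (p.1, ξ)) := by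
    funext p
    rw [← Prod.mk.eta (p := p), interaction_eq hF hG hf hg, Real.fourierInv_eq]
    rfl
  rw [h]
  refine StronglyMeasurable.integral_prod_right' (f := fun q : (ℝ × Space) × Space =>
    (Real.fourierChar (inner ℝ q.2 q.1.2) : ℂ) * (projSymbol χ mu q.2 *
      waveConv (m / (2 * Real.pi)) ε F G (q.1.1, q.2))) ?_
  refine StronglyMeasurable.mul ?_ ?_
  · have : Continuous fun q : (ℝ × Space) × Space =>
        (Real.fourierChar (inner ℝ q.2 q.1.2) : ℂ) := by fun_prop
    exact this.stronglyMeasurable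
  · exact (stronglyMeasurable_projSymbol_mul_waveConv hF hG).comp_measurable
      (g := fun q : (ℝ × Space) × Space => (q.1.1, q.2)) (by fun_prop)

theorem eLpNorm_interaction_eq (hF : IsBandlimited F Λ) (hG : IsBandlimited G Λ')
    (hf : ∀ t, propagator m t f =ᵐ[volume] 𝓕⁻ (evolve (m / (2 * Real.pi)) t F))
    (hg : ∀ t, propagator m t g =ᵐ[volume] 𝓕⁻ (evolve (m / (2 * Real.pi)) t G)) :
    eLpNorm (interaction χ m mu ε f g) 2 volume =
      eLpNorm (fun p : ℝ × Space =>
        projSymbol χ mu p.2 * waveConv (m / (2 * Real.pi)) ε F G p) 2 volume := by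
  refine (ENNReal.pow_right_strictMono two_ne_zero).injective ?_
  rw [eLpNorm_sq_prod (stronglyMeasurable_interaction hF hG hf hg),
    eLpNorm_sq_prod (stronglyMeasurable_projSymbol_mul_waveConv hF hG)]
  refine lintegral_congr fun t => ?_
  simp only [interaction_eq hF hG hf hg]
  have hF1 := integrable_evolve (m := m / (2 * Real.pi)) (t := t) hF.stronglyMeasurable
    hF.integrable
  have hF2 := memLp_evolve (m := m / (2 * Real.pi)) (t := t) hF.stronglyMeasurable hF.memLp
  have hG1 := integrable_evolve (m := m / (2 * Real.pi)) (t := ε * t) hG.stronglyMeasurable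
    hG.integrable
  have hG2 := memLp_evolve (m := m / (2 * Real.pi)) (t := ε * t) hG.stronglyMeasurable hG.memLp
  have hsymb := memLp_projSymbol χ mu
  refine lintegral_enorm_sq_fourierInv ?_ ?_
  · exact memLp_one_iff_integrable.1
      ((memLp_one_iff_integrable.2 (integrable_conv hF1 hG1)).mul hsymb)
  · exact (memLp_conv hF1 hF2 hG1 hG2).mul hsymb

/-- Only two facts on `ρ_μ` enter: it is bounded by `B`, and its symbol is supported in `|ξ| ≤ μ/π ≤
μ`. -/
theorem eLpNorm_interaction_le {B : ℝ} (hB : ∀ lam s, |χ.rho lam s| ≤ B) (hmu : 1 ≤ mu)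
    (hF : IsBandlimited F Λ) (hG : IsBandlimited G Λ')
    (hf : ∀ t, propagator m t f =ᵐ[volume] 𝓕⁻ (evolve (m / (2 * Real.pi)) t F))
    (hg : ∀ t, propagator m t g =ᵐ[volume] 𝓕⁻ (evolve (m / (2 * Real.pi)) t G)) :
    eLpNorm (interaction χ m mu ε f g) 2 volume ≤ ENNReal.ofReal B *
      eLpNorm ({p : ℝ × Space | ‖p.2‖ ≤ mu}.indicator
        (waveConv (m / (2 * Real.pi)) ε F G)) 2 volume := by
  rw [eLpNorm_interaction_eq hF hG hf hg]
  refine eLpNorm_le_mul_eLpNorm_of_ae_le_mul (Filter.Eventually.of_forall fun p => ?_) 2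
  by_cases hp : ‖p.2‖ ≤ mu
  · rw [Set.indicator_of_mem (by exact hp), norm_mul]
    refine mul_le_mul_of_nonneg_right ?_ (norm_nonneg _)
    simpa [projSymbol] using hB mu (2 * Real.pi * ‖p.2‖)
  · have h0 : projSymbol χ mu p.2 = 0 := by
      by_contra h
      refine hp ((norm_le_of_projSymbol_ne_zero χ hmu h).trans (div_le_self (by linarith) ?_))
      linarith [Real.pi_gt_three]
    rw [Set.indicator_of_notMem (by exact hp), h0]
    simp

end Interaction

/-! ### The three bounds with explicit constants. -/

section Estimates

variable {m lam lam₁ lam₂ mu ε : ℝ} {F G : Space → ℂ} {Λ Λ' : ℝ}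

theorem add_div_pi_le (hm : 0 ≤ m) (hlam : 1 ≤ lam) : m + lam / Real.pi ≤ (m + 1) * lam := by
  have : lam / Real.pi ≤ lam := div_le_self (by linarith) (by linarith [Real.pi_gt_three])
  nlinarith

theorem bilin_le_min_frequency (hm : 0 ≤ m) (hlam : 1 ≤ lam)
    (hF : IsBandlimited F (lam / Real.pi)) (hG : IsBandlimited G Λ') :
    bilin m F G ≤ ENNReal.ofReal (3 * (m + 1) * lam) ^ 2 *
      ((∫⁻ η, ‖F η‖ₑ ^ 2) * ∫⁻ η, ‖G η‖ₑ ^ 2) := by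
  refine (hF.bilin_le_of_ball hm (by positivity) hG (h := 2 * (lam / Real.pi))
    fun η η' h h' => ?_).trans (mul_le_mul_left ?_ _)
  · linarith [norm_sub_le η η', hF.norm_le η h, hF.norm_le η' h']
  · rw [← ENNReal.ofReal_pow (by positivity)]
    refine ENNReal.ofReal_le_ofReal ?_
    have h1 := add_div_pi_le hm hlam
    have h2 : 4 * Real.pi * (2 * (lam / Real.pi)) = 8 * lam := by
      field_simp
      ring
    rw [h2]
    have h3 : (m + 1) * lam * lam ≤ ((m + 1) * lam) ^ 2 := by
      have : lam ≤ (m + 1) * lam := by nlinarith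
      rw [sq]
      exact mul_le_mul_of_nonneg_left this (by positivity)
    nlinarith

theorem eLpNorm_waveConv_le_min (hm : 0 ≤ m) (h₁ : 1 ≤ lam₁) (h₂ : 1 ≤ lam₂)
    (hε : ε = 1 ∨ ε = -1)
    (hF : IsBandlimited F (lam₁ / Real.pi)) (hG : IsBandlimited G (lam₂ / Real.pi)) :
    eLpNorm (waveConv m ε F G) 2 volume ≤ ENNReal.ofReal (3 * (m + 1) * min lam₁ lam₂) *
      (eLpNorm F 2 volume * eLpNorm G 2 volume) := by
  refine eLpNorm_waveConv_le hF hG hε ?_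
  rcases le_total lam₁ lam₂ with h | h
  · rw [min_eq_left h]
    exact bilin_le_min_frequency hm h₁ hF (hG.reflectSign ε)
  · rw [min_eq_right h, bilin_comm, mul_comm (∫⁻ η, ‖F η‖ₑ ^ 2)]
    exact bilin_le_min_frequency hm h₂ (hG.reflectSign ε) hF

theorem norm_sub_le_of_cut_ne_zero {h : ℝ} (hh : 0 < h) (k : Fin 3 → ℤ) (η η' : Space)
    (hη : cut h k F η ≠ 0) (hη' : cut h k F η' ≠ 0) : ‖η - η'‖ ≤ 2 * h :=
  norm_sub_le_of_cell_eq hh ((cut_ne_zero hη).1.trans (cut_ne_zero hη').1.symm)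

theorem eLpNorm_indicator_waveConv_le_sqrt (hm : 0 ≤ m) (hlam : 1 ≤ lam) (hmu : 1 ≤ mu)
    (hε : ε = 1 ∨ ε = -1) (hF : IsBandlimited F (lam / Real.pi)) (hG : IsBandlimited G Λ') :
    eLpNorm ({p : ℝ × Space | ‖p.2‖ ≤ mu}.indicator (waveConv m ε F G)) 2 volume ≤
      343 * ENNReal.ofReal (6 * (m + 1) * (mu ^ (1 / 2 : ℝ) * lam ^ (1 / 2 : ℝ))) *
        (eLpNorm F 2 volume * eLpNorm G 2 volume) := by
  have hmu0 : 0 < mu := by linarith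
  refine eLpNorm_indicator_waveConv_le_of_cells hF hG hε hmu0 fun k n _ => ?_
  refine ((hF.cut mu k).bilin_le_of_ball hm (by positivity) ((hG.cut mu (n - k)).reflectSign ε)
    (norm_sub_le_of_cut_ne_zero hmu0 k)).trans (mul_le_mul_left ?_ _)
  rw [← ENNReal.ofReal_pow (by positivity)]
  refine ENNReal.ofReal_le_ofReal ?_
  have h1 := add_div_pi_le hm hlam
  rw [mul_pow, mul_pow (mu ^ (1 / 2 : ℝ)), ← Real.sqrt_eq_rpow, ← Real.sqrt_eq_rpow,
    Real.sq_sqrt hmu0.le, Real.sq_sqrt (by linarith)]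
  have hpi := Real.pi_lt_d2
  -- Cells of side `μ` have diameter at most `2μ`, and `8π ≤ 36 = 6²`.
  calc 4 * Real.pi * (2 * mu) * (m + lam / Real.pi)
      ≤ 4 * Real.pi * (2 * mu) * ((m + 1) * lam) := by gcongr
    _ = (8 * Real.pi) * ((m + 1) * 1) * (mu * lam) := by ring
    _ ≤ 36 * ((m + 1) * (m + 1)) * (mu * lam) := by
        gcongr
        · linarith
        · linarith
    _ = _ := by ring

theorem eLpNorm_indicator_waveConv_le_output (hm : 0 ≤ m) (hlam : 1 ≤ lam) (hmu : 1 ≤ mu)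
    (hF : IsBandlimited F (lam / Real.pi)) (hG : IsBandlimited G Λ')
    (hlow : 1 < lam → ∀ η, F η ≠ 0 → lam / (4 * Real.pi) ≤ ‖η‖) :
    eLpNorm ({p : ℝ × Space | ‖p.2‖ ≤ mu}.indicator (waveConv m 1 F G)) 2 volume ≤
      343 * ENNReal.ofReal (800 * (m + 1) * mu) *
        (eLpNorm F 2 volume * eLpNorm G 2 volume) := by
  have hmu0 : 0 < mu := by linarith
  have hlam0 : 0 < lam := by linarith
  have hpi := Real.pi_lt_d2
  have hpi3 := Real.pi_gt_three
  -- The threshold is the condition `10 h ≤ ℓ` for `h = 2μ` and `ℓ = λ/(4π)`; it also forces `λ >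
  -- 1`, so that the lower frequency bound is available.
  rcases le_or_gt (80 * Real.pi * mu) lam with hsep | hsep
  · refine eLpNorm_indicator_waveConv_le_of_cells hF hG (Or.inl rfl) hmu0 fun k n hn => ?_
    rw [reflectSign, if_pos rfl]
    refine ((hF.cut mu k).bilin_le_of_transversal hm (by positivity) (hG.cut mu (n - k))
      (h := 2 * mu) (ℓ := lam / (4 * Real.pi)) (by positivity) (by positivity) ?_
      (fun η hη => hlow (by nlinarith) η (cut_ne_zero hη).2)
      (norm_sub_le_of_cut_ne_zero hmu0 k) ?_).trans (mul_le_mul_left ?_ _)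
    · rw [le_div_iff₀ (by positivity)]
      linarith
    · intro η ζ hη hζ
      have := norm_add_le_of_cell_add hmu0 (η := η) (ζ := ζ) (by
        rw [(cut_ne_zero hη).1, (cut_ne_zero hζ).1]
        simpa using hn)
      linarith
    · rw [← ENNReal.ofReal_pow (by positivity)]
      refine ENNReal.ofReal_le_ofReal ?_
      have h1 := add_div_pi_le hm hlam
      calc (2 * (2 * mu)) ^ 2 * ((m + lam / Real.pi) / (lam / (4 * Real.pi) / 2))
          ≤ (2 * (2 * mu)) ^ 2 * (((m + 1) * lam) / (lam / (4 * Real.pi) / 2)) := by gcongr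
        _ = (128 * Real.pi) * ((m + 1) * 1) * mu ^ 2 := by
            field_simp
            ring
        _ ≤ 640000 * ((m + 1) * (m + 1)) * mu ^ 2 := by
            gcongr
            · linarith
            · linarith
        _ = _ := by ring
  · have hb : bilin m F (reflectSign 1 G) ≤ ENNReal.ofReal (3 * (m + 1) * lam) ^ 2 *
        ((∫⁻ η, ‖F η‖ₑ ^ 2) * ∫⁻ η, ‖reflectSign 1 G η‖ₑ ^ 2) :=
      bilin_le_min_frequency hm hlam hF (hG.reflectSign 1)
    refine (eLpNorm_indicator_le _).trans
      ((eLpNorm_waveConv_le hF hG (Or.inl rfl) hb).trans (mul_le_mul_left ?_ _))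
    refine le_trans (ENNReal.ofReal_le_ofReal ?_)
      (le_mul_of_one_le_left zero_le (by norm_num))
    -- Here `80π < 252`, and `3 · 252 = 756 ≤ 800` accounts for the constant.
    have : lam ≤ 252 * mu := by nlinarith
    nlinarith

/-- Real bounds on the Fourier side give the bounds of the interaction. -/
theorem l2NormLe_interaction {χ : Cutoff} {m mu ε B N C : ℝ} {f g : L2} {F G : Space → ℂ}
    {Λ Λ' : ℝ} (hB0 : 0 ≤ B) (hB : ∀ lam s, |χ.rho lam s| ≤ B) (hmu : 1 ≤ mu) (hN : 0 ≤ N)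
    (hF : IsBandlimited F Λ) (hG : IsBandlimited G Λ')
    (hf : ∀ t, propagator m t f =ᵐ[volume] 𝓕⁻ (evolve (m / (2 * Real.pi)) t F))
    (hg : ∀ t, propagator m t g =ᵐ[volume] 𝓕⁻ (evolve (m / (2 * Real.pi)) t G))
    (hFn : eLpNorm F 2 volume = ENNReal.ofReal ‖f‖)
    (hGn : eLpNorm G 2 volume = ENNReal.ofReal ‖g‖)
    (hle : eLpNorm ({p : ℝ × Space | ‖p.2‖ ≤ mu}.indicator
        (waveConv (m / (2 * Real.pi)) ε F G)) 2 volume ≤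
      343 * ENNReal.ofReal N * (eLpNorm F 2 volume * eLpNorm G 2 volume))
    (hC : B * (343 * N) ≤ C) :
    L2NormLe (interaction χ m mu ε f g) (C * ‖f‖ * ‖g‖) := by
  have hbound : eLpNorm (interaction χ m mu ε f g) 2 volume ≤
      ENNReal.ofReal (C * ‖f‖ * ‖g‖) := by
    refine ((eLpNorm_interaction_le hB hmu hF hG hf hg).trans (mul_le_mul_right hle _)).trans ?_
    rw [hFn, hGn, show (343 : ℝ≥0∞) = ENNReal.ofReal 343 by simp,
      ← ENNReal.ofReal_mul (by norm_num), ← ENNReal.ofReal_mul (norm_nonneg _),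
      ← ENNReal.ofReal_mul (by positivity), ← ENNReal.ofReal_mul hB0]
    refine ENNReal.ofReal_le_ofReal ?_
    calc B * (343 * N * (‖f‖ * ‖g‖)) = B * (343 * N) * (‖f‖ * ‖g‖) := by ring
      _ ≤ C * (‖f‖ * ‖g‖) := by gcongr
      _ = _ := by ring
  exact ⟨⟨(stronglyMeasurable_interaction hF hG hf hg).aestronglyMeasurable,
    hbound.trans_lt ENNReal.ofReal_lt_top⟩, hbound⟩

end Estimates

end KleinGordon

end

theorem lemma3p3 (χ : KleinGordon.Cutoff) (m : ℝ) (hm : 0 ≤ m) (K : ℝ) (hK : 1 < K) :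
    ∃ C : ℝ, 0 < C ∧ ∀ mu lam₁ lam₂ : ℝ,
      KleinGordon.IsDyadic mu → KleinGordon.IsDyadic lam₁ → KleinGordon.IsDyadic lam₂ →
      1 ≤ mu → 1 ≤ lam₁ → 1 ≤ lam₂ → ∀ f g : KleinGordon.L2,
      -- (++) interaction
      ((K * lam₁ ≤ lam₂ ∨ K * lam₂ ≤ lam₁) →
        KleinGordon.L2NormLe
          (KleinGordon.interaction χ m mu 1
            (KleinGordon.proj χ lam₁ f) (KleinGordon.proj χ lam₂ g))
          (C * min lam₁ lam₂ *
            ‖KleinGordon.proj χ lam₁ f‖ * ‖KleinGordon.proj χ lam₂ g‖)) ∧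
      ((mu ≤ K * lam₁ ∧ lam₁ ≤ K * lam₂ ∧ lam₂ ≤ K * lam₁) →
        KleinGordon.L2NormLe
          (KleinGordon.interaction χ m mu 1
            (KleinGordon.proj χ lam₁ f) (KleinGordon.proj χ lam₂ g))
          (C * mu *
            ‖KleinGordon.proj χ lam₁ f‖ * ‖KleinGordon.proj χ lam₂ g‖)) ∧
      -- (+-) interaction
      ((K * lam₁ ≤ lam₂ ∨ K * lam₂ ≤ lam₁) →
        KleinGordon.L2NormLe
          (KleinGordon.interaction χ m mu (-1)
            (KleinGordon.proj χ lam₁ f) (KleinGordon.proj χ lam₂ g))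
          (C * min lam₁ lam₂ *
            ‖KleinGordon.proj χ lam₁ f‖ * ‖KleinGordon.proj χ lam₂ g‖)) ∧
      ((mu ≤ K * lam₁ ∧ lam₁ ≤ K * lam₂ ∧ lam₂ ≤ K * lam₁) →
        KleinGordon.L2NormLe
          (KleinGordon.interaction χ m mu (-1)
            (KleinGordon.proj χ lam₁ f) (KleinGordon.proj χ lam₂ g))
          (C * (mu ^ (1 / 2 : ℝ) * lam₁ ^ (1 / 2 : ℝ)) *
            ‖KleinGordon.proj χ lam₁ f‖ * ‖KleinGordon.proj χ lam₂ g‖)) := by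
  obtain ⟨B, hB0, hB⟩ := χ.exists_uniform_rho_bound
  set m' := m / (2 * Real.pi) with hm'
  have hm0 : 0 ≤ m' := by positivity
  -- `B` bounds the output symbol, `343` counts the values of `n`, and `800` dominates the constants
  -- `3` and `6` of the other two bounds.
  refine ⟨B * (343 * (800 * (m' + 1))), by positivity, ?_⟩
  intro mu lam₁ lam₂ _ _ _ hmu h₁ h₂ f g
  obtain ⟨F, hF, hlow, hFn, hf⟩ := KleinGordon.exists_fourier_of_proj χ m h₁ f
  obtain ⟨G, hG, -, hGn, hg⟩ := KleinGordon.exists_fourier_of_proj χ m h₂ g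
  have hmin : ∀ ε : ℝ, ε = 1 ∨ ε = -1 → KleinGordon.L2NormLe
      (KleinGordon.interaction χ m mu ε (KleinGordon.proj χ lam₁ f) (KleinGordon.proj χ lam₂ g))
      (B * (343 * (800 * (m' + 1))) * min lam₁ lam₂ *
        ‖KleinGordon.proj χ lam₁ f‖ * ‖KleinGordon.proj χ lam₂ g‖) := by
    intro ε hε
    have hpos : 0 < min lam₁ lam₂ := lt_min (by linarith) (by linarith)
    refine KleinGordon.l2NormLe_interaction (N := 3 * (m' + 1) * min lam₁ lam₂) hB0.le hB hmu
      (by positivity) hF hG hf hg hFn hGn ?_ ?_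
    · refine (eLpNorm_indicator_le _).trans
        ((KleinGordon.eLpNorm_waveConv_le_min hm0 h₁ h₂ hε hF hG).trans (mul_le_mul_left ?_ _))
      exact le_mul_of_one_le_left zero_le (by norm_num)
    · have : 0 ≤ B * ((m' + 1) * min lam₁ lam₂) := by positivity
      nlinarith
  refine ⟨fun _ => hmin 1 (Or.inl rfl), fun _ => ?_, fun _ => hmin (-1) (Or.inr rfl), fun _ => ?_⟩
  · exact KleinGordon.l2NormLe_interaction (N := 800 * (m' + 1) * mu) hB0.le hB hmu
      (by positivity) hF hG hf hg hFn hGn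
      (KleinGordon.eLpNorm_indicator_waveConv_le_output hm0 h₁ hmu hF hG hlow)
      (le_of_eq (by ring))
  · refine KleinGordon.l2NormLe_interaction
      (N := 6 * (m' + 1) * (mu ^ (1 / 2 : ℝ) * lam₁ ^ (1 / 2 : ℝ))) hB0.le hB hmu
      (by positivity) hF hG hf hg hFn hGn
      (KleinGordon.eLpNorm_indicator_waveConv_le_sqrt hm0 h₁ hmu (Or.inr rfl) hF hG) ?_
    have : 0 ≤ B * ((m' + 1) * (mu ^ (1 / 2 : ℝ) * lam₁ ^ (1 / 2 : ℝ))) := by positivity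
    nlinarith
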